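/- Consider the continuous-time totally asymmetric simple exclusion process (TASEP) on $\mathbb{Z}$: at most one particle per site, and each particle jumps to its right neighbour site at rate $1$ provided that site is empty. Label the particles $1,2,3,\ldots$ from right to left, let $x_1^n(t)\in\mathbb{Z}$ be the position at time $t\ge 0$ of the particle with label $n\ge 1$, and start from the step initial condition $x_1^n(0)=-n$ for all $n\geq 1$. For pairs in $\{1,2,\ldots\}\times[0,\infty)$ write $$(n,t)\prec(n',t')\iff n\ge n',\ t\le t'\text{ and }(n,t)\ne(n',t').$$ Let $(n_1,t_1)\prec(n_2,t_2)\prec\cdots\prec(n_m,t_m)$ and $s_1,\ldots,s_m\in\mathbb{R}$. Then $$\mathbb{P}\Big(\bigcap_{k=1}^m\{x_1^{n_k}(t_k)\ge s_k\}\Big)=\det(1-P_sKP_s)_{\ell^2(\{(n_1,t_1),\ldots,(n_m,t_m)\}\times\mathbb{Z})},$$ where $P_s$ is the multiplication by $P_s((n_k,t_k),x)=\mathbf 1_{[x<s_k]}$ and the Fredholm determinant is understood through its Fredholm series, that is, it equals $$\sum_{N\ge 0}\frac{(-1)^N}{N!}\sum_{\ell_1=1}^m\cdots\sum_{\ell_N=1}^m\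 \sum_{x_1<s_{\ell_1}}\cdots\sum_{x_N<s_{\ell_N}}\det\big(K(n_{\ell_i},t_{\ell_i},x_i;n_{\ell_j},t_{\ell_j},x_j)\big)_{i,j=1}^N ,$$ with all sums absolutely convergent. The kernel is $$\begin{aligned}K(n,t,x;n',t',x')=&-\mathbf 1_{[(n',t')\prec(n,t)]}\frac{1}{2\pi i}\oint_{\Gamma_0}dw\,\frac{1}{w^{x-x'+1}}\Big(\frac{w}{1-w}\Big)^{n'-n}e^{(t-t')w}\\&+\frac{1}{(2\pi i)^2}\oint_{\Gamma_1}dz\oint_{\Gamma_0}dw\,\frac{e^{tw}(1-w)^{n}}{w^{x+n+1}}\,\frac{z^{x'+n'}}{e^{t'z}(1-z)^{n'}}\,\frac{1}{w-z},\end{aligned}$$ where $\Gamma_0=\{|w|=r\}$ and $\Gamma_1=\{|z-1|=R\}$ are anticlockwise circles with arbitrary $r,R>0$, $r+R<1$. -/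

import Mathlib

open MeasureTheory
open scoped NNReal

/-! ### The totally asymmetric simple exclusion process, with labelled particles

A configuration is a function `x : ℕ+ → ℤ`; `x n` is the position of the particle with label `n`.
Particles are labelled from right to left, so the configurations of the process are strictly
decreasing functions. -/

/-- The backward generator of TASEP:
`(L f)(x) = ∑ₙ 1[site x n + 1 is empty] (f (x with particle n moved one step to the right) - f x)`.
It is applied to functions `f` that depend on finitely many particles; for such `f` and strictly
decreasing `x` only finitely many terms of the sum are nonzero. -/
noncomputable def tasepGenerator (f : (ℕ+ → ℤ) → ℝ) (x : ℕ+ → ℤ) : ℝ :=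
  open Classical in
  ∑' n : ℕ+, if ∀ j, x j ≠ x n + 1 then f (Function.update x n (x n + 1)) - f x else 0

/-- The transition semigroup `e^{tL} f = ∑ₖ (tᵏ / k!) Lᵏ f` of TASEP, for bounded functions `f` that
depend on finitely many particles. (If `f` depends on the first `N` particles only, then so does
`L f` on strictly decreasing configurations, and `|L f| ≤ 2 N sup |f|` there, so that the series
converges absolutely.) -/
noncomputable def tasepSemigroup (t : ℝ≥0) (f : (ℕ+ → ℤ) → ℝ) (x : ℕ+ → ℤ) : ℝ :=
  ∑' k : ℕ, ((t : ℝ) ^ k / (k.factorial : ℝ)) * (tasepGenerator^[k] f) x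

/-- The information carried by the process `X` up to time `s`. -/
def tasepPast {Ω : Type*} (X : ℝ≥0 → Ω → (ℕ+ → ℤ)) (s : ℝ≥0) : MeasurableSpace Ω :=
  ⨆ r : ℝ≥0, ⨆ _ : r ≤ s, MeasurableSpace.comap (X r) inferInstance

/-- `X` is a TASEP with step initial condition under the probability measure `μ`:
`X t ω n` is the position at time `t` of the particle with label `n`; at time `0` particle `n` is
at `-n`; and `X` is a Markov process, with values in the strictly decreasing configurations, whose
transition semigroup is `e^{tL}`. -/
structure IsStepTASEP {Ω : Type*} [MeasurableSpace Ω] (μ : Measure Ω)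
    (X : ℝ≥0 → Ω → (ℕ+ → ℤ)) : Prop where
  measurable : ∀ t, Measurable (X t)
  initial : ∀ᵐ ω ∂μ, ∀ n : ℕ+, X 0 ω n = -((n : ℕ) : ℤ)
  ordered : ∀ t, ∀ᵐ ω ∂μ, StrictAnti (X t ω)
  markov : ∀ (s t : ℝ≥0) (f : (ℕ+ → ℤ) → ℝ),
    (∃ S : Finset ℕ+, DependsOn f (S : Set ℕ+)) → (∃ C : ℝ, ∀ x, |f x| ≤ C) →
    μ[fun ω => f (X (s + t) ω) | tasepPast X s] =ᵐ[μ] fun ω => tasepSemigroup t f (X s ω)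

/-! ### Space-like order and kernel -/

/-- `(n₁, t₁) ≺ (n₂, t₂)`: `n₁ ≥ n₂`, `t₁ ≤ t₂` and the two pairs are different. -/
def SpaceLikePrec (a b : ℕ × ℝ) : Prop :=
  b.1 ≤ a.1 ∧ a.2 ≤ b.2 ∧ a ≠ b

/-- The correlation kernel `K(n₁, t₁, x₁; n₂, t₂, x₂)`. The contour around `0` is the
anticlockwise circle `|w| = r`, the one around `1` the anticlockwise circle `|z - 1| = R`; for
`0 < r`, `0 < R`, `r + R < 1` each of them encloses no other pole of the integrand. -/
noncomputable def tasepKernel (r R : ℝ) (n₁ : ℕ) (t₁ : ℝ) (x₁ : ℤ) (n₂ : ℕ) (t₂ : ℝ) (x₂ : ℤ) : ℂ :=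
  open Classical in
  -(if SpaceLikePrec (n₂, t₂) (n₁, t₁) then
      (2 * Real.pi * Complex.I)⁻¹ *
        ∮ w in C(0, r), (1 / w ^ (x₁ - x₂ + 1)) * (w / (1 - w)) ^ ((n₂ : ℤ) - (n₁ : ℤ)) *
          Complex.exp (((t₁ - t₂ : ℝ) : ℂ) * w)
    else 0) +
  ((2 * Real.pi * Complex.I) ^ 2)⁻¹ *
    ∮ z in C(1, R), ∮ w in C(0, r),
      (Complex.exp ((t₁ : ℂ) * w) * (1 - w) ^ n₁ / w ^ (x₁ + (n₁ : ℤ) + 1)) *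
      (z ^ (x₂ + (n₂ : ℤ)) / (Complex.exp ((t₂ : ℂ) * z) * (1 - z) ^ n₂)) *
      (1 / (w - z))

/-! ### Fredholm determinants on a discrete space -/

/-- `det(1 - K)` on `ℓ²(ι)` exists as a Fredholm series and equals `d`, i.e.
`d = ∑ₖ ((-1)ᵏ / k!) ∑_{y₁, …, yₖ ∈ ι} det (K (yᵢ, yⱼ))_{i,j ≤ k}`, where all sums converge
absolutely. -/
def HasFredholmDet {ι : Type*} (K : ι → ι → ℂ) (d : ℂ) : Prop :=
  (∀ k : ℕ, Summable fun y : Fin k → ι => (Matrix.of fun i j : Fin k => K (y i) (y j)).det) ∧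
  HasSum (fun k : ℕ => ((-1 : ℂ) ^ k / (k.factorial : ℂ)) *
    ∑' y : Fin k → ι, (Matrix.of fun i j : Fin k => K (y i) (y j)).det) d

/-- The kernel of `P_s K P_s` on `{(n₁, t₁), …, (nₘ, tₘ)} × ℤ`, where `(a, x)` stands for
`((n_a, t_a), x)` and `P_s` is the multiplication by `1[x < s_a]`. -/
noncomputable def cutKernel {m : ℕ} (s : Fin m → ℝ) (K : Fin m × ℤ → Fin m × ℤ → ℂ)
    (p q : Fin m × ℤ) : ℂ :=
  (if (p.2 : ℝ) < s p.1 then 1 else 0) * K p q * (if (q.2 : ℝ) < s q.1 then 1 else 0)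

/-!
Ask that every particle `j ≤ N` has made at least `c j` jumps, with `c` weakly decreasing. The
generator maps the indicator of this event to a finite combination of such indicators: particle `j`
attains the bound `c j` at rate `1`, and exclusion blocks the jump only if `c (j + 1) = c j`, in
which case the constraint on `j` already follows from the one on `j + 1`. The principal minors of
`1 - K` over the windows `0 ≤ u < c j` of sites shifted by their label satisfy the same closed
equation with the same initial values, which determines them by induction on `∑ j, c j`. The order
`≺` allows one to run through the points `(n k, t k)` in turn: at time `t k` the constraint on
particle `n k` is moved, without changing either side, from the current time to the past. Finally,
at negative sites the shifted kernel is strictly triangular in the index of the point and has no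
entries towards nonnegative sites, so that its Fredholm series is that of a finite matrix.
-/

/-! ### Circle integrals -/

section CircleIntegral

variable {E : Type*} [NormedAddCommGroup E] [NormedSpace ℂ E]

theorem continuous_deriv_circleMap (c : ℂ) (ρ : ℝ) : Continuous (deriv (circleMap c ρ)) :=
  (contDiff_circleMap c ρ (n := 1)).continuous_deriv_one

theorem hasDerivAt_circleIntegral {c : ℂ} {ρ : ℝ} (hρ : 0 ≤ ρ) {F F' : ℝ → ℂ → E}
    (hF : ∀ t, ContinuousOn (F t) (Metric.sphere c ρ))
    (hF' : ContinuousOn (fun p : ℝ × ℂ => F' p.1 p.2) (Set.univ ×ˢ Metric.sphere c ρ))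
    (hderiv : ∀ t, ∀ z ∈ Metric.sphere c ρ, HasDerivAt (fun t => F t z) (F' t z) t) (t : ℝ) :
    HasDerivAt (fun t => ∮ z in C(c, ρ), F t z) (∮ z in C(c, ρ), F' t z) t := by
  have hmem : ∀ θ, circleMap c ρ θ ∈ Metric.sphere c ρ := circleMap_mem_sphere c hρ
  have hcont : ∀ s, Continuous fun θ => deriv (circleMap c ρ) θ • F s (circleMap c ρ θ) := fun s =>
    (continuous_deriv_circleMap c ρ).smul ((hF s).comp_continuous (continuous_circleMap c ρ) hmem)
  have hcont' : Continuous fun p : ℝ × ℝ =>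
      deriv (circleMap c ρ) p.2 • F' p.1 (circleMap c ρ p.2) :=
    ((continuous_deriv_circleMap c ρ).comp continuous_snd).smul
      (hF'.comp_continuous
        (continuous_fst.prodMk ((continuous_circleMap c ρ).comp continuous_snd))
        fun p => ⟨Set.mem_univ _, hmem p.2⟩)
  obtain ⟨C, hC⟩ := ((isCompact_Icc (a := t - 1) (b := t + 1)).prod
    (isCompact_Icc (a := 0) (b := 2 * Real.pi))).exists_bound_of_continuousOn hcont'.continuousOn
  refine (intervalIntegral.hasDerivAt_integral_of_dominated_loc_of_deriv_le
    (F' := fun s θ => deriv (circleMap c ρ) θ • F' s (circleMap c ρ θ)) (bound := fun _ => C)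
    (Icc_mem_nhds (sub_one_lt t) (lt_add_one t))
    (Filter.Eventually.of_forall fun s => (hcont s).aestronglyMeasurable)
    ((hcont t).intervalIntegrable _ _)
    (hcont'.comp (Continuous.prodMk_right t)).aestronglyMeasurable
    (Filter.Eventually.of_forall fun θ hθ s hs => ?_) intervalIntegrable_const
    (Filter.Eventually.of_forall fun θ _ s _ => (hderiv s _ (hmem θ)).const_smul _)).2
  rw [Set.uIoc_of_le Real.two_pi_pos.le] at hθ
  exact hC (s, θ) ⟨hs, Set.Ioc_subset_Icc_self hθ⟩

theorem circleIntegral_circleIntegral_swap {c d : ℂ} {r R : ℝ} (hr : 0 ≤ r) (hR : 0 ≤ R)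
    {f : ℂ → ℂ → E}
    (hf : ContinuousOn (fun p : ℂ × ℂ => f p.1 p.2) (Metric.sphere c r ×ˢ Metric.sphere d R)) :
    (∮ z in C(c, r), ∮ w in C(d, R), f z w) = ∮ w in C(d, R), ∮ z in C(c, r), f z w := by
  have hcont : Continuous fun p : ℝ × ℝ => deriv (circleMap c r) p.1 •
      deriv (circleMap d R) p.2 • f (circleMap c r p.1) (circleMap d R p.2) := by
    have hf' : Continuous fun p : ℝ × ℝ => f (circleMap c r p.1) (circleMap d R p.2) :=
      hf.comp_continuous (f := fun p : ℝ × ℝ => (circleMap c r p.1, circleMap d R p.2))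
        (by fun_prop) fun p => ⟨circleMap_mem_sphere c hr _, circleMap_mem_sphere d hR _⟩
    exact ((continuous_deriv_circleMap c r).comp continuous_fst).smul
      (((continuous_deriv_circleMap d R).comp continuous_snd).smul hf')
  simp only [circleIntegral]
  simp_rw [← intervalIntegral.integral_smul]
  simp_rw [intervalIntegral.integral_of_le Real.two_pi_pos.le]
  rw [integral_integral_swap]
  · simp_rw [smul_comm (deriv (circleMap c r) _)]
  · rw [Measure.prod_restrict]
    exact (hcont.continuousOn.integrableOn_compact (isCompact_Icc.prod isCompact_Icc)).mono_set
      (Set.prod_mono Set.Ioc_subset_Icc_self Set.Ioc_subset_Icc_self)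

end CircleIntegral

/-! ### The contour integrals in the kernel -/

/-- The function `e^{tw} (1 - w)^p w^k`. Both factors of the double contour integral in
`tasepKernel` are of this form. -/
noncomputable def expMonomial (p k : ℤ) (t : ℝ) (w : ℂ) : ℂ :=
  Complex.exp (t * w) * ((1 - w) ^ p * w ^ k)

/-- The integral `(2πi)⁻¹ ∮ e^{tw} (1 - w)^p w^k dw` along the circle `|w - c| = ρ`. -/
noncomputable def expMonomialIntegral (c : ℂ) (ρ : ℝ) (p k : ℤ) (t : ℝ) : ℂ :=
  (2 * Real.pi * Complex.I)⁻¹ * ∮ w in C(c, ρ), expMonomial p k t w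

section ExpMonomial

variable {c : ℂ} {ρ : ℝ} {p k : ℤ} {t : ℝ}

theorem expMonomial_add_one_left {w : ℂ} (h0 : w ≠ 0) (h1 : w ≠ 1) :
    expMonomial (p + 1) k t w = expMonomial p k t w - expMonomial p (k + 1) t w := by
  simp only [expMonomial, zpow_add_one₀ h0, zpow_add_one₀ (sub_ne_zero.2 h1.symm)]
  ring

theorem differentiableOn_expMonomial {s : Set ℂ} (h0 : (0 : ℂ) ∉ s ∨ 0 ≤ k)
    (h1 : (1 : ℂ) ∉ s ∨ 0 ≤ p) : DifferentiableOn ℂ (expMonomial p k t) s := by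
  intro w hw
  have hpow : DifferentiableAt ℂ (fun w : ℂ => w ^ k) w :=
    differentiableAt_id.zpow (h0.imp_left fun h => ne_of_mem_of_not_mem hw h)
  have hpow' : DifferentiableAt ℂ (fun w : ℂ => (1 - w) ^ p) w :=
    (differentiableAt_id.const_sub 1).zpow
      (h1.imp_left fun h => sub_ne_zero.2 (ne_of_mem_of_not_mem hw h).symm)
  have hexp : DifferentiableAt ℂ (fun w : ℂ => Complex.exp (t * w)) w := by fun_prop
  exact (hexp.mul (hpow'.mul hpow)).differentiableWithinAt

theorem continuousOn_expMonomial {s : Set ℂ} (h0 : (0 : ℂ) ∉ s) (h1 : (1 : ℂ) ∉ s) :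
    ContinuousOn (expMonomial p k t) s :=
  (differentiableOn_expMonomial (Or.inl h0) (Or.inl h1)).continuousOn

theorem circleIntegrable_expMonomial (hρ : 0 ≤ ρ) (h0 : (0 : ℂ) ∉ Metric.sphere c ρ)
    (h1 : (1 : ℂ) ∉ Metric.sphere c ρ) : CircleIntegrable (expMonomial p k t) c ρ :=
  (continuousOn_expMonomial h0 h1).circleIntegrable hρ

theorem expMonomialIntegral_add_one_left (hρ : 0 ≤ ρ) (h0 : (0 : ℂ) ∉ Metric.sphere c ρ)
    (h1 : (1 : ℂ) ∉ Metric.sphere c ρ) :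
    expMonomialIntegral c ρ (p + 1) k t =
      expMonomialIntegral c ρ p k t - expMonomialIntegral c ρ p (k + 1) t := by
  simp only [expMonomialIntegral]
  rw [← mul_sub, ← circleIntegral.integral_sub (circleIntegrable_expMonomial hρ h0 h1)
    (circleIntegrable_expMonomial hρ h0 h1)]
  congr 1
  exact circleIntegral.integral_congr hρ fun w hw =>
    expMonomial_add_one_left (ne_of_mem_of_not_mem hw h0) (ne_of_mem_of_not_mem hw h1)

theorem hasDerivAt_expMonomialIntegral (hρ : 0 ≤ ρ) (h0 : (0 : ℂ) ∉ Metric.sphere c ρ)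
    (h1 : (1 : ℂ) ∉ Metric.sphere c ρ) :
    HasDerivAt (expMonomialIntegral c ρ p k) (expMonomialIntegral c ρ p (k + 1) t) t := by
  refine (hasDerivAt_circleIntegral hρ (fun t => continuousOn_expMonomial h0 h1) ?_
    (fun t w hw => ?_) t).const_mul _
  · have hexp : Continuous fun q : ℝ × ℂ => Complex.exp (q.1 * q.2) := by fun_prop
    have hmono := (continuousOn_expMonomial (p := p) (k := k + 1) (t := 0) h0 h1).comp
      continuousOn_snd fun (q : ℝ × ℂ) (hq : q ∈ Set.univ ×ˢ Metric.sphere c ρ) => hq.2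
    refine (hexp.continuousOn.mul hmono).congr fun q _ => ?_
    simp [expMonomial]
  · have hexp : HasDerivAt (fun t : ℝ => Complex.exp (t * w))
        (Complex.exp (t * w) * (1 * w)) t :=
      (Complex.ofRealCLM.hasDerivAt.mul_const w).cexp
    refine (hexp.mul_const ((1 - w) ^ p * w ^ k)).congr_deriv ?_
    rw [expMonomial, zpow_add_one₀ (ne_of_mem_of_not_mem hw h0)]
    ring

theorem expMonomialIntegral_eq_zero (hρ : 0 ≤ ρ) (h0 : (0 : ℂ) ∉ Metric.closedBall c ρ ∨ 0 ≤ k)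
    (h1 : (1 : ℂ) ∉ Metric.closedBall c ρ ∨ 0 ≤ p) : expMonomialIntegral c ρ p k t = 0 := by
  rw [expMonomialIntegral, ((differentiableOn_expMonomial h0 h1).diffContOnCl_ball
    subset_rfl).circleIntegral_eq_zero hρ, mul_zero]

theorem expMonomialIntegral_zero_zero_zero (hρ : ρ ≠ 0) :
    expMonomialIntegral 0 ρ 0 k 0 = if k = -1 then 1 else 0 := by
  have hmono : expMonomial 0 k 0 = fun w => (w - 0) ^ k := by ext w; simp [expMonomial]
  rw [expMonomialIntegral, hmono]
  split_ifs with hk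
  · simp only [hk, zpow_neg_one, circleIntegral.integral_sub_center_inv 0 hρ,
      inv_mul_cancel₀ Complex.two_pi_I_ne_zero]
  · rw [circleIntegral.integral_sub_zpow_of_ne hk, mul_zero]

theorem expMonomialIntegral_one_zero_zero (hρ : ρ ≠ 0) :
    expMonomialIntegral 1 ρ p 0 0 = if p = -1 then -1 else 0 := by
  have hmono : expMonomial p 0 0 = fun w => (-1) ^ p * (w - 1) ^ p := by
    ext w
    rw [← mul_zpow]
    simp [expMonomial]
  rw [expMonomialIntegral, hmono, circleIntegral.integral_const_mul]
  split_ifs with hp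
  · simp only [hp, zpow_neg_one, circleIntegral.integral_sub_center_inv 1 hρ]
    rw [mul_left_comm, inv_mul_cancel₀ Complex.two_pi_I_ne_zero]
    norm_num
  · rw [circleIntegral.integral_sub_zpow_of_ne hp, mul_zero, mul_zero]

end ExpMonomial

section Radius

variable {r R : ℝ}

theorem zero_notMem_sphere_zero (hr : 0 < r) : (0 : ℂ) ∉ Metric.sphere 0 r := by
  simpa using hr.ne

theorem one_notMem_sphere_one (hR : 0 < R) : (1 : ℂ) ∉ Metric.sphere 1 R := by
  simpa using hR.ne

theorem one_notMem_closedBall_zero (hr : r < 1) : (1 : ℂ) ∉ Metric.closedBall 0 r := by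
  simpa using hr

theorem zero_notMem_closedBall_one (hR : R < 1) : (0 : ℂ) ∉ Metric.closedBall 1 R := by
  simpa using hR

theorem one_notMem_sphere_zero (hr : r < 1) : (1 : ℂ) ∉ Metric.sphere 0 r := fun h =>
  one_notMem_closedBall_zero hr (Metric.sphere_subset_closedBall h)

theorem zero_notMem_sphere_one (hR : R < 1) : (0 : ℂ) ∉ Metric.sphere 1 R := fun h =>
  zero_notMem_closedBall_one hR (Metric.sphere_subset_closedBall h)

theorem notMem_closedBall_one_of_mem_sphere_zero (hrR : r + R < 1) {w : ℂ}
    (hw : w ∈ Metric.sphere 0 r) : w ∉ Metric.closedBall 1 R :=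
  fun hw' => Set.disjoint_left.1 (Metric.closedBall_disjoint_closedBall (by simpa using hrR))
    (Metric.sphere_subset_closedBall hw) hw'

end Radius

/-- The function `Ψ_p(t, u) = (2πi)⁻¹ ∮_{|w| = r} e^{tw} (1 - w)^p w^{-u-1} dw`, the transition
function of the determinantal process. The argument `u` is a position shifted by the label, `x + n`.
-/
noncomputable def kernelPsi (r : ℝ) (p : ℤ) (t : ℝ) (u : ℤ) : ℂ :=
  expMonomialIntegral 0 r p (-u - 1) t

/-- The function `Φ_q(t, u) = (2πi)⁻¹ ∮_{|z - 1| = R} e^{-tz} (1 - z)^{-q} z^u dz`, biorthogonal to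
the functions `kernelPsi`. The argument `u` is a position shifted by the label, `x + n`. -/
noncomputable def kernelPhi (R : ℝ) (q : ℤ) (t : ℝ) (u : ℤ) : ℂ :=
  expMonomialIntegral 1 R (-q) u (-t)

section PsiPhi

variable {r R : ℝ} {t : ℝ} {u : ℤ}

theorem kernelPsi_add_one (hr : 0 < r) (hr1 : r < 1) (p : ℤ) :
    kernelPsi r (p + 1) t u = kernelPsi r p t u - kernelPsi r p t (u - 1) := by
  rw [kernelPsi, expMonomialIntegral_add_one_left hr.le (zero_notMem_sphere_zero hr)
    (one_notMem_sphere_zero hr1), kernelPsi, kernelPsi]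
  ring_nf

theorem hasDerivAt_kernelPsi (hr : 0 < r) (hr1 : r < 1) (p : ℤ) :
    HasDerivAt (fun t => kernelPsi r p t u) (kernelPsi r p t (u - 1)) t := by
  refine (hasDerivAt_expMonomialIntegral hr.le (zero_notMem_sphere_zero hr)
    (one_notMem_sphere_zero hr1)).congr_deriv ?_
  rw [kernelPsi]
  ring_nf

theorem kernelPsi_of_neg (hr : 0 < r) (hr1 : r < 1) (p : ℤ) (hu : u < 0) :
    kernelPsi r p t u = 0 :=
  expMonomialIntegral_eq_zero hr.le (Or.inr (by omega)) (Or.inl (one_notMem_closedBall_zero hr1))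

theorem kernelPsi_zero_zero (hr : 0 < r) : kernelPsi r 0 0 u = if u = 0 then 1 else 0 := by
  rw [kernelPsi, expMonomialIntegral_zero_zero_zero hr.ne']
  congr 1
  exact propext (by omega)

theorem kernelPhi_zero (hR : 0 < R) (hR1 : R < 1) : kernelPhi R 0 t u = 0 :=
  expMonomialIntegral_eq_zero hR.le (Or.inl (zero_notMem_closedBall_one hR1)) (Or.inr (by simp))

theorem kernelPhi_eq_sub (hR : 0 < R) (hR1 : R < 1) (q : ℤ) :
    kernelPhi R q t u = kernelPhi R (q + 1) t u - kernelPhi R (q + 1) t (u + 1) := by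
  rw [kernelPhi, show -q = -(q + 1) + 1 by ring, expMonomialIntegral_add_one_left hR.le
    (zero_notMem_sphere_one hR1) (one_notMem_sphere_one hR), kernelPhi, kernelPhi]

theorem hasDerivAt_kernelPhi (hR : 0 < R) (hR1 : R < 1) (q : ℤ) :
    HasDerivAt (fun t => kernelPhi R q t u) (-kernelPhi R q t (u + 1)) t := by
  refine ((hasDerivAt_expMonomialIntegral hR.le (zero_notMem_sphere_one hR1)
    (one_notMem_sphere_one hR)).scomp t (hasDerivAt_neg t)).congr_deriv ?_
  rw [neg_one_smul, kernelPhi]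

theorem kernelPhi_zero_zero (hR : 0 < R) (q : ℤ) :
    kernelPhi R q 0 0 = if q = 1 then -1 else 0 := by
  rw [kernelPhi, neg_zero, expMonomialIntegral_one_zero_zero hR.ne']
  simp only [neg_inj]

end PsiPhi

/-- The finite-rank kernel `∑_{k < n'} Ψ_{n-k-1}(t, u) Φ_{n'-k}(t', u')`, which is minus the double
contour integral in `tasepKernel` (with `u = x + n` and `u' = x' + n'`). -/
noncomputable def finiteRankKernel (r R : ℝ) (n : ℕ) (t : ℝ) (u : ℤ) (n' : ℕ) (t' : ℝ)
    (u' : ℤ) : ℂ :=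
  ∑ k ∈ Finset.range n', kernelPsi r (n - k - 1) t u * kernelPhi R (n' - k) t' u'

section DoubleIntegral

variable {r R : ℝ}

theorem inv_sub_eq_neg_geom_sum_add {K : Type*} [Field K] {a b : K} (ha : a ≠ 0) (hab : b ≠ a)
    (q : ℕ) :
    (b - a)⁻¹ = ∑ k ∈ Finset.range q, -(b ^ k / a ^ (k + 1)) + (b / a) ^ q * (b - a)⁻¹ := by
  have hba : b - a ≠ 0 := sub_ne_zero.2 hab
  induction q with
  | zero => simp
  | succ q ih =>
    rw [Finset.sum_range_succ, add_assoc]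
    refine ih.trans ?_
    congr 1
    simp only [div_pow, pow_succ]
    field_simp
    ring

theorem expMonomial_neg_mul_inv_sub {w z : ℂ} (hz : z ≠ 1) (hw : w ≠ 1) (hwz : w ≠ z) (q : ℕ)
    (u : ℤ) (t : ℝ) :
    expMonomial (-q) u t z * (w - z)⁻¹ =
      ∑ k ∈ Finset.range q, -((1 - w) ^ (k + 1))⁻¹ * expMonomial (-(q - k)) u t z +
        ((1 - w) ^ q)⁻¹ * (expMonomial 0 u t z * (w - z)⁻¹) := by
  have hz1 : 1 - z ≠ 0 := sub_ne_zero.2 hz.symm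
  have hgeom := inv_sub_eq_neg_geom_sum_add (sub_ne_zero.2 hw.symm) (b := 1 - z)
    (by simpa using hwz.symm) q
  rw [sub_sub_sub_cancel_left] at hgeom
  conv_lhs => rw [hgeom]
  rw [mul_add, Finset.mul_sum]
  congr 1
  · refine Finset.sum_congr rfl fun k _ => ?_
    simp only [expMonomial, show (-(q - k) : ℤ) = -q + k by ring, zpow_add₀ hz1, zpow_natCast]
    ring
  · simp only [expMonomial, zpow_neg, zpow_natCast, zpow_zero, one_mul, div_pow]
    field_simp

theorem circleIntegral_expMonomial_mul_inv_sub (hR : 0 < R) (hR1 : R < 1) {w : ℂ}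
    (hw : w ∉ Metric.closedBall (1 : ℂ) R) (q : ℕ) (t : ℝ) (u : ℤ) :
    (2 * Real.pi * Complex.I)⁻¹ *
        ∮ z in C(1, R), expMonomial (-q) u (-t) z * (w - z)⁻¹ =
      ∑ k ∈ Finset.range q, -((1 - w) ^ (k + 1))⁻¹ * kernelPhi R (q - k) t u := by
  have h0 := zero_notMem_closedBall_one hR1
  have hwz : ∀ z ∈ Metric.closedBall (1 : ℂ) R, w ≠ z := fun z hz =>
    (ne_of_mem_of_not_mem hz hw).symm
  have hw1 : w ≠ 1 := hwz 1 (Metric.mem_closedBall_self hR.le)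
  have hintegrable : ∀ k : ℕ, CircleIntegrable
      (fun z => -((1 - w) ^ (k + 1))⁻¹ * expMonomial (-(q - k)) u (-t) z) 1 R := fun k =>
    (circleIntegrable_expMonomial hR.le (zero_notMem_sphere_one hR1)
      (one_notMem_sphere_one hR)).const_smul
  have hdiff : DifferentiableOn ℂ
      (fun z => ((1 - w) ^ q)⁻¹ * (expMonomial 0 u (-t) z * (w - z)⁻¹))
      (Metric.closedBall 1 R) :=
    ((differentiableOn_expMonomial (Or.inl h0) (Or.inr le_rfl)).mul
      ((differentiableOn_id.const_sub w).inv fun z hz => sub_ne_zero.2 (hwz z hz))).const_mul _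
  have hanalytic := (hdiff.diffContOnCl_ball subset_rfl).circleIntegral_eq_zero hR.le
  rw [circleIntegral.integral_congr hR.le fun z hz => expMonomial_neg_mul_inv_sub
      (ne_of_mem_of_not_mem hz (one_notMem_sphere_one hR)) hw1
      (hwz z (Metric.sphere_subset_closedBall hz)) q u (-t),
    circleIntegral.integral_add (CircleIntegrable.fun_sum _ fun k _ => hintegrable k)
      ((hdiff.continuousOn.mono Metric.sphere_subset_closedBall).circleIntegrable hR.le),
    hanalytic, add_zero, circleIntegral.integral_fun_sum fun k _ => hintegrable k, Finset.mul_sum]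
  simp only [circleIntegral.integral_const_mul, kernelPhi, expMonomialIntegral, mul_left_comm]

theorem circleIntegral_expMonomial_mul_expMonomial_mul_inv_sub (hR : 0 < R) (hR1 : R < 1) {w : ℂ}
    (hw : w ∉ Metric.closedBall 1 R) (p k : ℤ) (t : ℝ) (n' : ℕ) (t' : ℝ) (u' : ℤ) :
    (2 * Real.pi * Complex.I)⁻¹ * (∮ z in C(1, R),
        expMonomial p k t w * expMonomial (-n') u' (-t') z * (w - z)⁻¹) =
      ∑ j ∈ Finset.range n', -kernelPhi R (n' - j) t' u' * expMonomial (p - j - 1) k t w := by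
  have hw1 : 1 - w ≠ 0 :=
    sub_ne_zero.2 (ne_of_mem_of_not_mem (Metric.mem_closedBall_self hR.le) hw)
  simp only [mul_assoc (expMonomial _ _ _ w), circleIntegral.integral_const_mul]
  rw [mul_left_comm, circleIntegral_expMonomial_mul_inv_sub hR hR1 hw, Finset.mul_sum]
  refine Finset.sum_congr rfl fun j _ => ?_
  have hpow : (1 - w) ^ (p - j - 1) = (1 - w) ^ p * ((1 - w) ^ (j + 1))⁻¹ := by
    rw [sub_sub, zpow_sub₀ hw1, div_eq_mul_inv]
    norm_cast
  simp only [expMonomial, hpow]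
  ring

theorem circleIntegral_circleIntegral_expMonomial (hr : 0 < r) (hR : 0 < R)
    (hrR : r + R < 1) (n : ℕ) (t : ℝ) (u : ℤ) (n' : ℕ) (t' : ℝ) (u' : ℤ) :
    ((2 * Real.pi * Complex.I) ^ 2)⁻¹ * ∮ z in C(1, R), ∮ w in C(0, r),
        expMonomial n (-u - 1) t w * expMonomial (-n') u' (-t') z * (w - z)⁻¹ =
      -finiteRankKernel r R n t u n' t' u' := by
  have hr1 : r < 1 := by linarith
  have hR1 : R < 1 := by linarith
  have hcontinuous : ContinuousOn (fun p : ℂ × ℂ =>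
      expMonomial n (-u - 1) t p.2 * expMonomial (-n') u' (-t') p.1 * (p.2 - p.1)⁻¹)
      (Metric.sphere 1 R ×ˢ Metric.sphere 0 r) := by
    refine ContinuousOn.mul (ContinuousOn.mul ?_ ?_) ((by fun_prop : ContinuousOn
      (fun p : ℂ × ℂ => p.2 - p.1) _).inv₀ fun p hp => ?_)
    · exact (continuousOn_expMonomial (zero_notMem_sphere_zero hr)
        (one_notMem_sphere_zero hr1)).comp continuousOn_snd fun p hp => hp.2
    · exact (continuousOn_expMonomial (zero_notMem_sphere_one hR1)
        (one_notMem_sphere_one hR)).comp continuousOn_fst fun p hp => hp.1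
    · exact sub_ne_zero.2 (ne_of_mem_of_not_mem (Metric.sphere_subset_closedBall hp.1)
        (notMem_closedBall_one_of_mem_sphere_zero hrR hp.2)).symm
  have hintegrable : ∀ k : ℕ, CircleIntegrable
      (fun w => -kernelPhi R (n' - k) t' u' * expMonomial (n - k - 1) (-u - 1) t w) 0 r := fun k =>
    (circleIntegrable_expMonomial hr.le (zero_notMem_sphere_zero hr)
      (one_notMem_sphere_zero hr1)).const_smul
  rw [circleIntegral_circleIntegral_swap hR.le hr.le hcontinuous, pow_two, mul_inv, mul_assoc,
    ← circleIntegral.integral_const_mul, circleIntegral.integral_congr hr.le fun w hw =>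
      circleIntegral_expMonomial_mul_expMonomial_mul_inv_sub hR hR1
        (notMem_closedBall_one_of_mem_sphere_zero hrR hw) n (-u - 1) t n' t' u',
    circleIntegral.integral_fun_sum fun k _ => hintegrable k, finiteRankKernel, Finset.mul_sum,
    ← Finset.sum_neg_distrib]
  refine Finset.sum_congr rfl fun k _ => ?_
  rw [circleIntegral.integral_const_mul, kernelPsi, expMonomialIntegral]
  ring

theorem tasepKernel_eq_neg_add (hr : 0 < r) (hR : 0 < R) (hrR : r + R < 1) (n : ℕ) (t : ℝ)
    (x : ℤ) (n' : ℕ) (t' : ℝ) (x' : ℤ) [Decidable (SpaceLikePrec (n', t') (n, t))] :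
    tasepKernel r R n t x n' t' x' =
      -((if SpaceLikePrec (n', t') (n, t) then
          kernelPsi r (n - n') (t - t') ((x + n) - (x' + n')) else 0) +
        finiteRankKernel r R n t (x + n) n' t' (x' + n')) := by
  have hsingle : ∀ w ∈ Metric.sphere (0 : ℂ) r,
      (1 / w ^ (x - x' + 1)) * (w / (1 - w)) ^ ((n' : ℤ) - (n : ℤ)) *
        Complex.exp (((t - t' : ℝ) : ℂ) * w) =
      expMonomial (n - n') (-((x + n) - (x' + n')) - 1) (t - t') w := by
    intro w hw
    have hw0 : w ≠ 0 := ne_of_mem_of_not_mem hw (zero_notMem_sphere_zero hr)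
    rw [expMonomial, show (-((x + n) - (x' + n')) - 1 : ℤ) = (n' - n) - (x - x' + 1) by ring,
      zpow_sub₀ hw0, div_zpow, ← neg_sub (n' : ℤ), zpow_neg]
    ring
  have hdouble : ∀ z w : ℂ,
      Complex.exp ((t : ℂ) * w) * (1 - w) ^ n / w ^ (x + (n : ℤ) + 1) *
        (z ^ (x' + (n' : ℤ)) / (Complex.exp ((t' : ℂ) * z) * (1 - z) ^ n')) * (1 / (w - z)) =
      expMonomial n (-(x + n) - 1) t w * expMonomial (-n') (x' + n') (-t') z * (w - z)⁻¹ := by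
    intro z w
    simp only [expMonomial, ← neg_add', zpow_neg, zpow_natCast, Complex.ofReal_neg, neg_mul,
      Complex.exp_neg]
    field_simp
  simp only [tasepKernel, hdouble]
  rw [circleIntegral_circleIntegral_expMonomial hr hR hrR, neg_add,
    circleIntegral.integral_congr hr.le hsingle]
  congr 2
  split_ifs <;> rfl

end DoubleIntegral

/-! ### Principal minors -/

section PrincipalMinor

variable {I α : Type*} [DecidableEq I] [CommRing α]

/-- The minor of the (possibly infinite) matrix `M` with rows and columns in the finite set `W`. -/
def principalMinor (M : Matrix I I α) (W : Finset I) : α :=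
  (M.submatrix ((↑) : W → I) (↑)).det

theorem principalMinor_transpose (M : Matrix I I α) (W : Finset I) :
    principalMinor M.transpose W = principalMinor M W := by
  rw [principalMinor, ← Matrix.transpose_submatrix, Matrix.det_transpose, principalMinor]

theorem principalMinor_empty (M : Matrix I I α) : principalMinor M ∅ = 1 :=
  Matrix.det_isEmpty

theorem principalMinor_map {J : Type*} [DecidableEq J] (f : J ↪ I) (M : Matrix I I α)
    (W : Finset J) : principalMinor M (W.map f) = principalMinor (M.submatrix f f) W := by
  let e : W ≃ W.map f := Equiv.ofBijective (fun w => ⟨f w, Finset.mem_map_of_mem f w.2⟩)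
    ⟨fun _ _ h => Subtype.ext (f.injective (Subtype.ext_iff.1 h)), fun ⟨y, hy⟩ =>
      let ⟨w, hw, hwy⟩ := Finset.mem_map.1 hy
      ⟨⟨w, hw⟩, Subtype.ext hwy⟩⟩
  rw [principalMinor, ← Matrix.det_submatrix_equiv_self e]
  rfl

theorem principalMinor_erase (M : Matrix I I α) {W : Finset I} {i : I} (hi : i ∈ W) :
    principalMinor M (W.erase i) =
      ((M.submatrix ((↑) : W → I) (↑)).updateRow ⟨i, hi⟩ (Pi.single ⟨i, hi⟩ 1)).det := by
  have hrows : (M.submatrix ((↑) : W → I) (↑)).updateRow ⟨i, hi⟩ (Pi.single ⟨i, hi⟩ 1) =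
      Matrix.of ((Finset.univ.erase ⟨i, hi⟩).piecewise (M.submatrix ((↑) : W → I) (↑)).row
        (1 : Matrix W W α).row) := by
    ext p q
    rw [Matrix.of_apply]
    by_cases hp : p = ⟨i, hi⟩
    · rw [hp, Matrix.updateRow_self, Finset.piecewise_eq_of_notMem _ _ _ (Finset.notMem_erase _ _),
        Matrix.row_apply, Matrix.one_eq_pi_single]
    · rw [Matrix.updateRow_ne hp, Finset.piecewise_eq_of_mem _ _ _
        (Finset.mem_erase.2 ⟨hp, Finset.mem_univ p⟩), Matrix.row_apply]
  have herase : (W.erase i) =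
      (Finset.univ.erase (⟨i, hi⟩ : W)).map (Function.Embedding.subtype (· ∈ W)) := by
    ext j
    simp [and_comm]
  rw [hrows, Matrix.det_piecewise_one_eq_submatrix_det, herase, principalMinor_map]
  rfl

theorem det_updateCol_single {n : Type*} [Fintype n] [DecidableEq n] (A : Matrix n n α) (i : n) :
    (A.updateCol i (Pi.single i 1)).det = (A.updateRow i (Pi.single i 1)).det := by
  rw [← Matrix.adjugate_apply, ← Matrix.det_transpose, ← Matrix.updateRow_transpose,
    ← Matrix.adjugate_apply, ← Matrix.adjugate_transpose, Matrix.transpose_apply]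

theorem det_updateCol_eq_principalMinor_sub (M : Matrix I I α) {W S : Finset I} {i : I}
    (hi : i ∈ W) (hS : S ⊆ W) (hiS : i ∉ S) {v : W → α}
    (hv : ∀ p : W, v p = (M - 1) p i - ∑ j ∈ S, M p j) :
    ((M.submatrix ((↑) : W → I) (↑)).updateCol ⟨i, hi⟩ v).det =
      principalMinor M W - principalMinor M (W.erase i) := by
  set A := M.submatrix ((↑) : W → I) ((↑) : W → I) with hA
  have hv' : v = A.col ⟨i, hi⟩ - ∑ j ∈ S.subtype (· ∈ W), A.col j - Pi.single ⟨i, hi⟩ 1 := by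
    ext p
    have hsum : ∑ j ∈ S.subtype (· ∈ W), M p j = ∑ j ∈ S, M p j :=
      Finset.sum_subtype_of_mem (M p) fun j hj => hS hj
    simp only [hv p, Pi.sub_apply, Finset.sum_apply, Matrix.col_apply, hA, Matrix.submatrix_apply,
      hsum, Matrix.sub_apply, Matrix.one_apply, Pi.single_apply, Subtype.ext_iff]
    ring
  have hcol : ∀ j : W, A.cramer (A.col j) = Pi.single j A.det := fun j =>
    A.cramer_row_self _ j fun _ => rfl
  have hother : ∀ j ∈ S.subtype (· ∈ W), (Pi.single j A.det : W → α) ⟨i, hi⟩ = 0 := fun j hj =>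
    Pi.single_eq_of_ne (fun h => hiS (by simpa [← h] using hj)) _
  rw [← Matrix.cramer_apply, hv', map_sub, map_sub, map_sum, Pi.sub_apply, Pi.sub_apply,
    Finset.sum_apply, Finset.sum_congr rfl fun j _ => congrFun (hcol j) _,
    Finset.sum_eq_zero hother, hcol, Pi.single_eq_same, sub_zero, Matrix.cramer_apply,
    det_updateCol_single, ← principalMinor_erase M hi]
  rfl

theorem principalMinor_erase_of_col (M : Matrix I I α) {W S : Finset I} {i : I} (hi : i ∈ W)
    (hS : S ⊆ W) (hiS : i ∉ S) (h : ∀ p ∈ W, (M - 1) p i = ∑ j ∈ S, M p j) :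
    principalMinor M (W.erase i) = principalMinor M W := by
  have hzero := det_updateCol_eq_principalMinor_sub M hi hS hiS (v := 0) fun p => by
    rw [h p p.2, sub_self, Pi.zero_apply]
  rw [Matrix.det_eq_zero_of_column_eq_zero ⟨i, hi⟩ fun p => by
    rw [Matrix.updateCol_self, Pi.zero_apply]] at hzero
  exact (sub_eq_zero.1 hzero.symm).symm

theorem principalMinor_erase_of_row (M : Matrix I I α) {W S : Finset I} {i : I} (hi : i ∈ W)
    (hS : S ⊆ W) (hiS : i ∉ S) (h : ∀ q ∈ W, (M - 1) i q = ∑ j ∈ S, M j q) :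
    principalMinor M (W.erase i) = principalMinor M W := by
  rw [← principalMinor_transpose M, ← principalMinor_transpose M]
  refine principalMinor_erase_of_col _ hi hS hiS fun p hp => ?_
  simpa only [Matrix.sub_apply, Matrix.transpose_apply, Matrix.one_apply, eq_comm] using h p hp

end PrincipalMinor

section HasDerivAtDet

variable {𝕜 𝔸 n : Type*} [NontriviallyNormedField 𝕜] [NormedCommRing 𝔸] [NormedAlgebra 𝕜 𝔸]
  [Fintype n] [DecidableEq n] {A : 𝕜 → Matrix n n 𝔸} {t : 𝕜}

theorem hasDerivAt_det {A' : Matrix n n 𝔸}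
    (h : ∀ i j, HasDerivAt (fun t => A t i j) (A' i j) t) :
    HasDerivAt (fun t => (A t).det) (∑ j, ((A t).updateCol j (A'.col j)).det) t := by
  simp only [Matrix.det_apply]
  rw [Finset.sum_comm]
  refine HasDerivAt.fun_sum fun σ _ => ?_
  rw [← Finset.smul_sum]
  refine HasDerivAt.const_smul _ ?_
  refine (HasDerivAt.fun_finsetProd fun i _ => h (σ i) i).congr_deriv ?_
  refine Finset.sum_congr rfl fun k _ => ?_
  rw [← Finset.mul_prod_erase _ _ (Finset.mem_univ k), Matrix.updateCol_self, smul_eq_mul, mul_comm]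
  congr 1
  exact Finset.prod_congr rfl fun i hi => (Matrix.updateCol_ne (Finset.ne_of_mem_erase hi)).symm

theorem sum_det_updateCol_eq_sum_det_updateRow {α : Type*} [CommRing α] (A B : Matrix n n α) :
    ∑ q, (A.updateCol q (B.col q)).det = ∑ p, (A.updateRow p (B.row p)).det := by
  simp_rw [← Matrix.cramer_apply, ← Matrix.cramer_transpose_apply,
    Matrix.cramer_eq_adjugate_mulVec, ← Matrix.adjugate_transpose, Matrix.mulVec, dotProduct,
    Matrix.transpose_apply]
  exact Finset.sum_comm

theorem hasDerivAt_det_of_sub {B C : Matrix n n 𝔸}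
    (h : ∀ i j, HasDerivAt (fun t => A t i j) (B i j - C i j) t) :
    HasDerivAt (fun t => (A t).det) (∑ i, ((A t).updateRow i (B.row i)).det -
      ∑ j, ((A t).updateCol j (C.col j)).det) t := by
  refine (hasDerivAt_det (A' := B - C) h).congr_deriv ?_
  rw [← sum_det_updateCol_eq_sum_det_updateRow, ← Finset.sum_sub_distrib]
  refine Finset.sum_congr rfl fun j _ => ?_
  simp_rw [← Matrix.cramer_apply]
  rw [← Pi.sub_apply, ← map_sub]
  rfl

end HasDerivAtDet

section SiteWindow

variable {ι : Type*}

/-- The sites `(a, u)` with `a ∈ A` and `0 ≤ u < c a`. -/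
noncomputable def siteWindow (A : Finset ι) (c : ι → ℕ) : Finset (ι × ℤ) :=
  (A.sigma fun a => Finset.Ico (0 : ℤ) (c a)).map (Equiv.sigmaEquivProd ι ℤ).toEmbedding

theorem mem_siteWindow {A : Finset ι} {c : ι → ℕ} {a : ι} {u : ℤ} :
    (a, u) ∈ siteWindow A c ↔ a ∈ A ∧ 0 ≤ u ∧ u < c a := by
  simp [siteWindow]

theorem sum_siteWindow {α : Type*} [AddCommMonoid α] (A : Finset ι) (c : ι → ℕ) (f : ι × ℤ → α) :
    ∑ p ∈ siteWindow A c, f p = ∑ a ∈ A, ∑ u ∈ Finset.Ico (0 : ℤ) (c a), f (a, u) := by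
  rw [siteWindow, Finset.sum_map, Finset.sum_sigma]
  rfl

theorem siteWindow_update_erase [DecidableEq ι] (A : Finset ι) (c : ι → ℕ) (a : ι) (v : ℕ) :
    (siteWindow A (Function.update c a (v + 1))).erase (a, (v : ℤ)) =
      siteWindow A (Function.update c a v) := by
  ext ⟨b, u⟩
  simp only [Finset.mem_erase, mem_siteWindow, ne_eq, Prod.mk.injEq, not_and]
  by_cases hb : b = a
  · subst hb
    simp only [Function.update_self, true_imp_iff]
    push_cast
    grind
  · simp [hb]

end SiteWindow

/-! ### The matrix `1 - K` along a chain -/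

section FiniteRankKernel

variable {r R : ℝ}

theorem finiteRankKernel_succ_left (hr : 0 < r) (hr1 : r < 1) (n : ℕ) (t : ℝ) (u : ℤ) (n' : ℕ)
    (t' : ℝ) (u' : ℤ) :
    finiteRankKernel r R (n + 1) t u n' t' u' =
      finiteRankKernel r R n t u n' t' u' - finiteRankKernel r R n t (u - 1) n' t' u' := by
  simp only [finiteRankKernel]
  rw [← Finset.sum_sub_distrib]
  refine Finset.sum_congr rfl fun k _ => ?_
  rw [← sub_mul, ← kernelPsi_add_one hr hr1]
  congr 2
  push_cast
  ring

theorem finiteRankKernel_succ_right (hR : 0 < R) (hR1 : R < 1) (n : ℕ) (t : ℝ) (u : ℤ) (n' : ℕ)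
    (t' : ℝ) (u' : ℤ) :
    finiteRankKernel r R n t u n' t' u' =
      finiteRankKernel r R n t u (n' + 1) t' u' -
        finiteRankKernel r R n t u (n' + 1) t' (u' + 1) := by
  have hlast := kernelPhi_eq_sub (t := t') (u := u') hR hR1 0
  rw [zero_add, kernelPhi_zero hR hR1] at hlast
  simp only [finiteRankKernel]
  rw [← Finset.sum_sub_distrib, Finset.sum_range_succ, ← mul_sub, Nat.cast_add_one,
    add_sub_cancel_left, ← hlast, mul_zero, add_zero]
  refine Finset.sum_congr rfl fun k _ => ?_
  rw [← mul_sub, kernelPhi_eq_sub hR hR1, ← sub_add_eq_add_sub]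

theorem finiteRankKernel_of_neg (hr : 0 < r) (hr1 : r < 1) (n : ℕ) (t : ℝ) {u : ℤ} (hu : u < 0)
    (n' : ℕ) (t' : ℝ) (u' : ℤ) : finiteRankKernel r R n t u n' t' u' = 0 :=
  Finset.sum_eq_zero fun k _ => by rw [kernelPsi_of_neg hr hr1 _ hu, zero_mul]

theorem finiteRankKernel_zero_right (n : ℕ) (t : ℝ) (u : ℤ) (t' : ℝ) (u' : ℤ) :
    finiteRankKernel r R n t u 0 t' u' = 0 :=
  Finset.sum_range_zero _

theorem hasDerivAt_finiteRankKernel_left (hr : 0 < r) (hr1 : r < 1) (n : ℕ) (t : ℝ) (u : ℤ)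
    (n' : ℕ) (t' : ℝ) (u' : ℤ) :
    HasDerivAt (fun t => finiteRankKernel r R n t u n' t' u')
      (finiteRankKernel r R n t (u - 1) n' t' u') t :=
  HasDerivAt.fun_sum fun _ _ => (hasDerivAt_kernelPsi hr hr1 _).mul_const _

theorem hasDerivAt_finiteRankKernel_right (hR : 0 < R) (hR1 : R < 1) (n : ℕ) (t : ℝ) (u : ℤ)
    (n' : ℕ) (t' : ℝ) (u' : ℤ) :
    HasDerivAt (fun t' => finiteRankKernel r R n t u n' t' u')
      (-finiteRankKernel r R n t u n' t' (u' + 1)) t' := by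
  simp only [finiteRankKernel]
  rw [← Finset.sum_neg_distrib]
  simp only [← mul_neg]
  exact HasDerivAt.fun_sum fun _ _ => (hasDerivAt_kernelPhi hR hR1 _).const_mul _

theorem hasDerivAt_finiteRankKernel (hr : 0 < r) (hr1 : r < 1) (hR : 0 < R) (hR1 : R < 1) (n : ℕ)
    (t : ℝ) (u : ℤ) (n' : ℕ) (u' : ℤ) :
    HasDerivAt (fun t => finiteRankKernel r R n t u n' t u')
      (finiteRankKernel r R n t (u - 1) n' t u' - finiteRankKernel r R n t u n' t (u' + 1)) t := by
  simp only [finiteRankKernel]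
  rw [← Finset.sum_sub_distrib]
  refine HasDerivAt.fun_sum fun k _ => ?_
  exact ((hasDerivAt_kernelPsi hr hr1 _).mul (hasDerivAt_kernelPhi hR hR1 _)).congr_deriv (by ring)

theorem finiteRankKernel_zero_zero (hR : 0 < R) (a : ℕ) (u : ℤ) {n : ℕ} (hn : 1 ≤ n) :
    finiteRankKernel r R a 0 u n 0 0 = -kernelPsi r (a - n) 0 u := by
  obtain ⟨n, rfl⟩ := Nat.exists_eq_add_of_le' hn
  rw [finiteRankKernel, Finset.sum_range_succ, Finset.sum_eq_zero fun k hk => ?_]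
  · rw [kernelPhi_zero_zero hR, if_pos (by push_cast; ring), zero_add, mul_neg_one,
      Nat.cast_add_one, sub_sub]
  · rw [kernelPhi_zero_zero hR, if_neg (by have := Finset.mem_range.1 hk; omega), mul_zero]

end FiniteRankKernel

/-- The kernel `K` at the points `a : ι` with label `lab a` and time `tim a`, which are related by
`prec`. The second coordinate of a site is position plus label, so that it is nonnegative for every
particle and vanishes at time `0`. -/
noncomputable def shiftedKernel (r R : ℝ) {ι : Type*} (lab : ι → ℕ) (tim : ι → ℝ)
    (prec : ι → ι → Prop) [DecidableRel prec] : Matrix (ι × ℤ) (ι × ℤ) ℂ :=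
  Matrix.of fun p q => -((if prec q.1 p.1 then
    kernelPsi r (lab p.1 - lab q.1) (tim p.1 - tim q.1) (p.2 - q.2) else 0) +
    finiteRankKernel r R (lab p.1) (tim p.1) p.2 (lab q.1) (tim q.1) q.2)

/-- The matrix `1 - K` for the past points `Sum.inl i`, ordered by their index, followed by all
labels `Sum.inr j` at the current time `T`, in decreasing order. -/
noncomputable def chainMatrix (r R : ℝ) {m : ℕ} (n : Fin m → ℕ) (t : Fin m → ℝ) (T : ℝ) :
    Matrix ((Fin m ⊕ ℕ) × ℤ) ((Fin m ⊕ ℕ) × ℤ) ℂ :=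
  1 - shiftedKernel r R (Sum.elim n id) (Sum.elim t fun _ => T) (Sum.Lex (· < ·) (· > ·))

section ChainMatrix

variable {r R : ℝ} {m : ℕ} {n : Fin m → ℕ} {t : Fin m → ℝ} {T : ℝ}

theorem chainMatrix_sub_one_apply (p q : (Fin m ⊕ ℕ) × ℤ) :
    (chainMatrix r R n t T - 1) p q =
      (if Sum.Lex (· < ·) (· > ·) q.1 p.1 then
        kernelPsi r (Sum.elim n id p.1 - Sum.elim n id q.1)
          (Sum.elim t (fun _ => T) p.1 - Sum.elim t (fun _ => T) q.1) (p.2 - q.2) else 0) +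
        finiteRankKernel r R (Sum.elim n id p.1) (Sum.elim t (fun _ => T) p.1) p.2
          (Sum.elim n id q.1) (Sum.elim t (fun _ => T) q.1) q.2 := by
  rw [chainMatrix, sub_sub_cancel_left, Matrix.neg_apply, shiftedKernel, Matrix.of_apply, neg_neg]

theorem chainMatrix_apply (p q : (Fin m ⊕ ℕ) × ℤ) :
    chainMatrix r R n t T p q = (chainMatrix r R n t T - 1) p q + if p = q then 1 else 0 := by
  rw [Matrix.sub_apply, Matrix.one_apply, sub_add_cancel]

theorem chainMatrix_sub_one_of_ne {p q : (Fin m ⊕ ℕ) × ℤ} (h : p ≠ q) :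
    (chainMatrix r R n t T - 1) p q = chainMatrix r R n t T p q := by
  rw [chainMatrix_apply p, if_neg h, add_zero]

theorem chainMatrix_inl_inr (i : Fin m) (u : ℤ) (b : ℕ) (v : ℤ) :
    chainMatrix r R n t T (Sum.inl i, u) (Sum.inr b, v) =
      finiteRankKernel r R (n i) (t i) u b T v := by
  rw [← chainMatrix_sub_one_of_ne (by simp), chainMatrix_sub_one_apply]
  simp

theorem chainMatrix_inr_inl (a : ℕ) (u : ℤ) (i : Fin m) (v : ℤ) :
    chainMatrix r R n t T (Sum.inr a, u) (Sum.inl i, v) =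
      kernelPsi r (a - n i) (T - t i) (u - v) + finiteRankKernel r R a T u (n i) (t i) v := by
  rw [← chainMatrix_sub_one_of_ne (by simp), chainMatrix_sub_one_apply]
  simp

theorem chainMatrix_sub_one_inr_inr (a : ℕ) (u : ℤ) (b : ℕ) (v : ℤ) :
    (chainMatrix r R n t T - 1) (Sum.inr a, u) (Sum.inr b, v) =
      (if a < b then kernelPsi r (a - b) 0 (u - v) else 0) + finiteRankKernel r R a T u b T v := by
  rw [chainMatrix_sub_one_apply]
  simp

theorem chainMatrix_inr_inr (hr : 0 < r) (a : ℕ) (u : ℤ) (b : ℕ) (v : ℤ) :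
    chainMatrix r R n t T (Sum.inr a, u) (Sum.inr b, v) =
      (if a ≤ b then kernelPsi r (a - b) 0 (u - v) else 0) + finiteRankKernel r R a T u b T v := by
  rw [chainMatrix_apply, chainMatrix_sub_one_inr_inr]
  rcases eq_or_ne a b with rfl | hab
  · simp [kernelPsi_zero_zero hr, sub_eq_zero, add_comm]
  · simp [hab, hab.le_iff_lt]

theorem chainMatrix_inr_succ_left (hr : 0 < r) (hr1 : r < 1) (j : ℕ) (u : ℤ)
    (q : (Fin m ⊕ ℕ) × ℤ) :
    chainMatrix r R n t T (Sum.inr (j + 1), u) q =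
      (chainMatrix r R n t T - 1) (Sum.inr j, u) q -
        (chainMatrix r R n t T - 1) (Sum.inr j, u - 1) q := by
  have hPsi (d : ℤ) (s : ℝ) (v : ℤ) : kernelPsi r ((j + 1 : ℕ) - d) s (u - v) =
      kernelPsi r (j - d) s (u - v) - kernelPsi r (j - d) s (u - 1 - v) := by
    rw [sub_right_comm u, ← kernelPsi_add_one hr hr1, Nat.cast_add_one, sub_add_eq_add_sub]
  obtain ⟨i | b, v⟩ := q
  · rw [chainMatrix_sub_one_of_ne (by simp), chainMatrix_sub_one_of_ne (by simp),
      chainMatrix_inr_inl, chainMatrix_inr_inl, chainMatrix_inr_inl, hPsi,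
      finiteRankKernel_succ_left hr hr1]
    ring
  · rw [chainMatrix_inr_inr hr, chainMatrix_sub_one_inr_inr, chainMatrix_sub_one_inr_inr,
      finiteRankKernel_succ_left hr hr1, hPsi]
    simp only [Nat.succ_le_iff]
    split_ifs <;> ring

theorem chainMatrix_inr_succ_right (hr : 0 < r) (hr1 : r < 1) (hR : 0 < R) (hR1 : R < 1) (j : ℕ)
    (u : ℤ) (p : (Fin m ⊕ ℕ) × ℤ) :
    chainMatrix r R n t T p (Sum.inr j, u) =
      (chainMatrix r R n t T - 1) p (Sum.inr (j + 1), u) -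
        (chainMatrix r R n t T - 1) p (Sum.inr (j + 1), u + 1) := by
  have hPsi (d v : ℤ) : kernelPsi r (d - j) 0 (v - u) =
      kernelPsi r (d - (j + 1 : ℕ)) 0 (v - u) - kernelPsi r (d - (j + 1 : ℕ)) 0 (v - (u + 1)) := by
    rw [← sub_sub v, ← kernelPsi_add_one hr hr1, Nat.cast_add_one, ← sub_sub, sub_add_cancel]
  obtain ⟨i | b, v⟩ := p
  · rw [chainMatrix_sub_one_of_ne (by simp), chainMatrix_sub_one_of_ne (by simp),
      chainMatrix_inl_inr, chainMatrix_inl_inr, chainMatrix_inl_inr,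
      finiteRankKernel_succ_right hR hR1]
  · rw [chainMatrix_inr_inr hr, chainMatrix_sub_one_inr_inr, chainMatrix_sub_one_inr_inr,
      finiteRankKernel_succ_right hR hR1 _ _ _ j, hPsi]
    simp only [Nat.lt_succ_iff]
    split_ifs <;> ring

theorem chainMatrix_of_neg (hr : 0 < r) (hr1 : r < 1) (a : Fin m ⊕ ℕ) {u : ℤ} (hu : u < 0)
    {q : (Fin m ⊕ ℕ) × ℤ} (hq : 0 ≤ q.2) : chainMatrix r R n t T (a, u) q = 0 := by
  have hne : (a, u) ≠ q := by rintro rfl; exact hu.not_ge hq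
  rw [← chainMatrix_sub_one_of_ne hne, chainMatrix_sub_one_apply,
    kernelPsi_of_neg hr hr1 _ (show u - q.2 < 0 by omega), ite_self, zero_add,
    finiteRankKernel_of_neg hr hr1 _ _ hu]

theorem chainMatrix_inr_zero_right {p : (Fin m ⊕ ℕ) × ℤ} (hp : p.1 ≠ Sum.inr 0) (u : ℤ) :
    chainMatrix r R n t T p (Sum.inr 0, u) = 0 := by
  obtain ⟨i | b, v⟩ := p
  · rw [chainMatrix_inl_inr, finiteRankKernel_zero_right]
  · have hb : b ≠ 0 := fun h => hp (congrArg Sum.inr h)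
    rw [← chainMatrix_sub_one_of_ne (by simp [hb]), chainMatrix_sub_one_inr_inr,
      if_neg (Nat.not_lt_zero b), finiteRankKernel_zero_right, zero_add]

theorem hasDerivAt_chainMatrix (hr : 0 < r) (hr1 : r < 1) (hR : 0 < R) (hR1 : R < 1)
    (p q : (Fin m ⊕ ℕ) × ℤ) :
    HasDerivAt (fun T => chainMatrix r R n t T p q)
      ((if p.1.isRight then chainMatrix r R n t T (p.1, p.2 - 1) q else 0) -
        if q.1.isRight then chainMatrix r R n t T p (q.1, q.2 + 1) else 0) T := by
  obtain ⟨a | a, u⟩ := p <;> obtain ⟨b | b, v⟩ := q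
  · simp only [chainMatrix_apply, chainMatrix_sub_one_apply]
    simpa using hasDerivAt_const _ _
  · simpa [chainMatrix_inl_inr] using hasDerivAt_finiteRankKernel_right hR hR1 _ _ _ _ _ _
  · have hPsi := (hasDerivAt_kernelPsi hr hr1 (a - n b) (u := u - v)).comp_sub_const T (t b)
    simpa [chainMatrix_inr_inl, sub_right_comm u 1 v] using
      hPsi.fun_add (hasDerivAt_finiteRankKernel_left hr hr1 a T u (n b) (t b) v)
  · simpa [chainMatrix_inr_inr hr, sub_right_comm u 1 v, ← sub_sub] using
      (hasDerivAt_finiteRankKernel hr hr1 hR hR1 a T u b v).const_add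
        (if a ≤ b then kernelPsi r (a - b) 0 (u - v) else 0)

theorem sum_range_chainMatrix_inr_succ (hr : 0 < r) (hr1 : r < 1) (j v : ℕ)
    {q : (Fin m ⊕ ℕ) × ℤ} (hq : 0 ≤ q.2) :
    ∑ u ∈ Finset.range (v + 1), chainMatrix r R n t T (Sum.inr (j + 1), (u : ℤ)) q =
      (chainMatrix r R n t T - 1) (Sum.inr j, (v : ℤ)) q := by
  have hneg : (chainMatrix r R n t T - 1) (Sum.inr j, -1) q = 0 := by
    rw [chainMatrix_sub_one_of_ne (by rintro rfl; omega),
      chainMatrix_of_neg hr hr1 _ neg_one_lt_zero hq]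
  induction v with
  | zero =>
    rw [zero_add, Finset.sum_range_one, chainMatrix_inr_succ_left hr hr1, Nat.cast_zero, zero_sub,
      hneg, sub_zero]
  | succ v ih =>
    rw [Finset.sum_range_succ, ih, chainMatrix_inr_succ_left hr hr1, Nat.cast_add_one,
      add_sub_cancel_right, add_sub_cancel]

/-! At the time of the last past point `k`, the two points `Sum.inl k` and `Sum.inr (n k)` describe
the same particle. -/

theorem chainMatrix_inl_eq_inr_left (hr : 0 < r) {k : Fin m} (hk : t k = T) (u : ℤ)
    {q : (Fin m ⊕ ℕ) × ℤ} (hl : ∀ i, q.1 = Sum.inl i → i ≤ k)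
    (hc : ∀ j, q.1 = Sum.inr j → j ≤ n k) :
    chainMatrix r R n t T (Sum.inl k, u) q = (chainMatrix r R n t T - 1) (Sum.inr (n k), u) q := by
  obtain ⟨i | j, v⟩ := q
  · rw [chainMatrix_sub_one_of_ne (by simp), chainMatrix_inr_inl, chainMatrix_apply,
      chainMatrix_sub_one_apply]
    rcases (hl i rfl).eq_or_lt with rfl | hik
    · simp [hk, kernelPsi_zero_zero hr, sub_eq_zero, add_comm]
    · simp [hk, hik, hik.ne']
  · rw [chainMatrix_inl_inr, chainMatrix_sub_one_inr_inr, if_neg (hc j rfl).not_gt, hk, zero_add]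

theorem chainMatrix_inr_eq_inl_right (hr : 0 < r) {k : Fin m} (hk : t k = T) (u : ℤ)
    {p : (Fin m ⊕ ℕ) × ℤ} (hl : ∀ i, p.1 = Sum.inl i → i ≤ k)
    (hc : ∀ j, p.1 = Sum.inr j → j ≤ n k) :
    chainMatrix r R n t T p (Sum.inr (n k), u) = (chainMatrix r R n t T - 1) p (Sum.inl k, u) := by
  obtain ⟨i | j, v⟩ := p
  · rw [chainMatrix_inl_inr, chainMatrix_sub_one_apply]
    simp [hk, hl i rfl]
  · rw [chainMatrix_sub_one_of_ne (by simp), chainMatrix_inr_inl, chainMatrix_inr_inr hr,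
      if_pos (hc j rfl), hk, sub_self]

theorem chainMatrix_zero_inr_zero_right (hr : 0 < r) (hR : 0 < R) {j : ℕ} (hj : 1 ≤ j) {b : ℕ}
    (hb : b ≤ j) (u : ℤ) : chainMatrix r R n t 0 (Sum.inr b, u) (Sum.inr j, 0) = 0 := by
  rw [chainMatrix_inr_inr hr, if_pos hb, finiteRankKernel_zero_zero hR _ _ hj, sub_zero,
    add_neg_cancel]

end ChainMatrix

/-! ### The chain determinant as a function of the constraints and of the current time -/

section WindowMinor

variable {ι α : Type*} [DecidableEq ι] [CommRing α] {A : Finset ι} {c : ι → ℕ} {a : ι} {u : ℤ}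

theorem det_updateRow_sub_one_eq_zero (M : Matrix (ι × ℤ) (ι × ℤ) α)
    (hp : (a, u) ∈ siteWindow A c) (hneg : ∀ q : ι × ℤ, 0 ≤ q.2 → M (a, -1) q = 0) :
    ((M.submatrix (Subtype.val : siteWindow A c → _) Subtype.val).updateRow ⟨(a, u), hp⟩
      fun q => M (a, u - 1) q).det = 0 := by
  obtain ⟨ha, hu, huc⟩ := mem_siteWindow.1 hp
  rcases hu.eq_or_lt with rfl | hu
  · refine Matrix.det_eq_zero_of_row_eq_zero ⟨(a, 0), hp⟩ fun q => ?_
    rw [Matrix.updateRow_self, zero_sub, hneg _ (mem_siteWindow.1 q.2).2.1]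
  · have hp' : (a, u - 1) ∈ siteWindow A c := mem_siteWindow.2 ⟨ha, by omega, by omega⟩
    exact Matrix.det_updateRow_eq_zero
      (M := M.submatrix (Subtype.val : siteWindow A c → _) Subtype.val)
      (i := ⟨(a, u - 1), hp'⟩) (j := ⟨(a, u), hp⟩) (by simp)

theorem det_updateCol_add_one_eq_zero (M : Matrix (ι × ℤ) (ι × ℤ) α)
    (hq : (a, u) ∈ siteWindow A c) (huc : u + 1 < c a) :
    ((M.submatrix (Subtype.val : siteWindow A c → _) Subtype.val).updateCol ⟨(a, u), hq⟩
      fun p => M p (a, u + 1)).det = 0 := by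
  obtain ⟨ha, hu, -⟩ := mem_siteWindow.1 hq
  have hq' : (a, u + 1) ∈ siteWindow A c := mem_siteWindow.2 ⟨ha, by omega, huc⟩
  exact Matrix.det_updateCol_eq_zero
    (M := M.submatrix (Subtype.val : siteWindow A c → _) Subtype.val)
    (i := ⟨(a, u + 1), hq'⟩) (j := ⟨(a, u), hq⟩) (by simp)

end WindowMinor

/-- All past points, and the points at the current time with labels `1, …, N`. -/
def chainPoints (m N : ℕ) : Finset (Fin m ⊕ ℕ) := Finset.univ.disjSum (Finset.Icc 1 N)

/-- The determinant of `1 - K` over the sites `0 ≤ u < c a` of the points `a` of the chain; it will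
turn out to be the probability that every particle `a` has made at least `c a` jumps. -/
noncomputable def chainDet (r R : ℝ) {m : ℕ} (n : Fin m → ℕ) (t : Fin m → ℝ) (N : ℕ) (T : ℝ)
    (c : Fin m ⊕ ℕ → ℕ) : ℂ :=
  principalMinor (chainMatrix r R n t T) (siteWindow (chainPoints m N) c)

section ChainDet

variable {r R : ℝ} {m : ℕ} {n : Fin m → ℕ} {t : Fin m → ℝ} {N : ℕ} {T : ℝ} {c : Fin m ⊕ ℕ → ℕ}

theorem inl_mem_chainPoints (i : Fin m) : Sum.inl i ∈ chainPoints m N := by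
  simp [chainPoints]

theorem inr_mem_chainPoints {j : ℕ} :
    (Sum.inr j : Fin m ⊕ ℕ) ∈ chainPoints m N ↔ 1 ≤ j ∧ j ≤ N := by
  simp [chainPoints]

theorem det_updateCol_chainMatrix_top (hr : 0 < r) (hr1 : r < 1) (hR : 0 < R) (hR1 : R < 1)
    {b v : ℕ} (hq : (Sum.inr (b + 1), (v : ℤ)) ∈ siteWindow (chainPoints m N) c)
    (hv : c (Sum.inr (b + 1)) = v + 1) (hb : 1 ≤ b → v + 1 ≤ c (Sum.inr b)) :
    (((chainMatrix r R n t T).submatrix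
      (Subtype.val : siteWindow (chainPoints m N) c → _) Subtype.val).updateCol
        ⟨(Sum.inr (b + 1), v), hq⟩ fun p =>
          chainMatrix r R n t T p (Sum.inr (b + 1), (v : ℤ) + 1)).det =
      chainDet r R n t N T c -
        chainDet r R n t N T (Function.update c (Sum.inr (b + 1)) v) := by
  have hbN := (inr_mem_chainPoints.1 (mem_siteWindow.1 hq).1).2
  have hcol (p : siteWindow (chainPoints m N) c) :
      chainMatrix r R n t T p (Sum.inr (b + 1), (v : ℤ) + 1) =
        (chainMatrix r R n t T - 1) p (Sum.inr (b + 1), v) -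
          chainMatrix r R n t T p (Sum.inr b, v) := by
    have hp : (p : (Fin m ⊕ ℕ) × ℤ) ≠ (Sum.inr (b + 1), (v : ℤ) + 1) := fun hp => by
      have := mem_siteWindow.1 (hp ▸ p.2)
      omega
    rw [chainMatrix_inr_succ_right hr hr1 hR hR1 b, sub_sub_cancel, chainMatrix_sub_one_of_ne hp]
  rw [chainDet, chainDet, ← siteWindow_update_erase, ← hv, Function.update_eq_self]
  rcases Nat.eq_zero_or_pos b with rfl | hb0
  · refine det_updateCol_eq_principalMinor_sub _ hq (Finset.empty_subset _)
      (Finset.notMem_empty _) fun p => ?_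
    have hp : p.1.1 ≠ Sum.inr 0 := fun h => by
      have := (mem_siteWindow.1 p.2).1
      rw [h, inr_mem_chainPoints] at this
      omega
    rw [hcol, chainMatrix_inr_zero_right hp, Finset.sum_empty]
  · refine det_updateCol_eq_principalMinor_sub _ hq (S := {(Sum.inr b, (v : ℤ))}) ?_ (by simp)
      fun p => by rw [hcol, Finset.sum_singleton]
    have := hb hb0
    rw [Finset.singleton_subset_iff, mem_siteWindow, inr_mem_chainPoints]
    omega

theorem det_updateCol_chainMatrix_inr (hr : 0 < r) (hr1 : r < 1) (hR : 0 < R) (hR1 : R < 1)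
    (hc : ∀ j, 1 ≤ j → j + 1 ≤ N → c (Sum.inr (j + 1)) ≤ c (Sum.inr j)) {j : ℕ} {u : ℤ}
    (hq : (Sum.inr j, u) ∈ siteWindow (chainPoints m N) c) :
    (((chainMatrix r R n t T).submatrix
      (Subtype.val : siteWindow (chainPoints m N) c → _) Subtype.val).updateCol ⟨(Sum.inr j, u), hq⟩
        fun p => chainMatrix r R n t T p (Sum.inr j, u + 1)).det =
      if u + 1 = c (Sum.inr j) then chainDet r R n t N T c -
        chainDet r R n t N T (Function.update c (Sum.inr j) (c (Sum.inr j) - 1)) else 0 := by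
  obtain ⟨hj, hu, huc⟩ := mem_siteWindow.1 hq
  obtain ⟨hj1, hjN⟩ := inr_mem_chainPoints.1 hj
  split_ifs with htop
  · obtain ⟨b, rfl⟩ := Nat.exists_eq_add_of_le' hj1
    obtain ⟨v, rfl⟩ := Int.eq_ofNat_of_zero_le hu
    have hv : c (Sum.inr (b + 1)) = v + 1 := by omega
    rw [det_updateCol_chainMatrix_top hr hr1 hR hR1 hq hv fun hb => hv ▸ hc b hb hjN, hv,
      Nat.add_sub_cancel]
  · exact det_updateCol_add_one_eq_zero _ hq (by omega)

theorem sum_siteWindow_chainPoints_top (f : ℕ → ℂ) :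
    ∑ q ∈ siteWindow (chainPoints m N) c, Sum.elim (fun _ => 0)
      (fun j => if q.2 + 1 = c (Sum.inr j) then f j else 0) q.1 =
      ∑ j ∈ Finset.Icc 1 N, if c (Sum.inr j) = 0 then 0 else f j := by
  rw [sum_siteWindow, chainPoints, Finset.sum_disjSum]
  simp only [Sum.elim_inl, Sum.elim_inr, Finset.sum_const_zero, zero_add, ← eq_sub_iff_add_eq,
    Finset.sum_ite_eq', Finset.mem_Ico]
  refine Finset.sum_congr rfl fun j _ => ?_
  split_ifs <;> first | rfl | omega

/-- In the derivative of the chain determinant lowering a row gives nothing, and raising a column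
contributes only at the top of the window of each current label. -/
theorem hasDerivAt_chainDet (hr : 0 < r) (hr1 : r < 1) (hR : 0 < R) (hR1 : R < 1)
    (hc : ∀ j, 1 ≤ j → j + 1 ≤ N → c (Sum.inr (j + 1)) ≤ c (Sum.inr j)) :
    HasDerivAt (fun T => chainDet r R n t N T c)
      (∑ j ∈ Finset.Icc 1 N,
        (chainDet r R n t N T (Function.update c (Sum.inr j) (c (Sum.inr j) - 1)) -
          chainDet r R n t N T c)) T := by
  set W := siteWindow (chainPoints m N) c
  refine (hasDerivAt_det_of_sub
    (A := fun T => (chainMatrix r R n t T).submatrix (Subtype.val : W → _) Subtype.val)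
    (B := Matrix.of fun p q => if p.1.1.isRight then
      chainMatrix r R n t T (p.1.1, p.1.2 - 1) q else 0)
    (C := Matrix.of fun p q => if q.1.1.isRight then
      chainMatrix r R n t T p (q.1.1, q.1.2 + 1) else 0) fun p q =>
    hasDerivAt_chainMatrix hr hr1 hR hR1 p.1 q.1).congr_deriv ?_
  let top : (Fin m ⊕ ℕ) × ℤ → ℂ := fun q => Sum.elim (fun _ => 0) (fun j =>
    if q.2 + 1 = c (Sum.inr j) then chainDet r R n t N T c -
      chainDet r R n t N T (Function.update c (Sum.inr j) (c (Sum.inr j) - 1)) else 0) q.1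
  refine (congrArg₂ (· - ·) (Finset.sum_eq_zero ?_)
    (Finset.sum_congr (g := fun q : W => top q) rfl ?_)).trans ?_
  · rintro ⟨⟨i | j, u⟩, hp⟩ -
    · exact Matrix.det_eq_zero_of_row_eq_zero ⟨(Sum.inl i, u), hp⟩ fun q =>
        congrFun Matrix.updateRow_self _
    · exact det_updateRow_sub_one_eq_zero _ hp fun q =>
        chainMatrix_of_neg hr hr1 _ neg_one_lt_zero
  · rintro ⟨⟨i | j, u⟩, hq⟩ -
    · exact Matrix.det_eq_zero_of_column_eq_zero ⟨(Sum.inl i, u), hq⟩ fun p =>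
        Matrix.updateCol_self
    · exact det_updateCol_chainMatrix_inr hr hr1 hR hR1 hc hq
  · rw [zero_sub, Finset.sum_coe_sort W top, sum_siteWindow_chainPoints_top,
      ← Finset.sum_neg_distrib]
    refine Finset.sum_congr rfl fun j _ => ?_
    split_ifs with hj
    · rw [hj, Nat.zero_sub, Function.update_eq_self_iff.2 hj.symm, sub_self, neg_zero]
    · rw [neg_sub]

theorem chainDet_update_succ_of_le (hr : 0 < r) (hr1 : r < 1) {j v : ℕ} (hj : 1 ≤ j)
    (hjN : j + 1 ≤ N) (hv : v + 1 ≤ c (Sum.inr (j + 1))) :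
    chainDet r R n t N T (Function.update c (Sum.inr j) v) =
      chainDet r R n t N T (Function.update c (Sum.inr j) (v + 1)) := by
  have hsucc : (Sum.inr (j + 1) : Fin m ⊕ ℕ) ≠ Sum.inr j := by simp
  rw [chainDet, ← siteWindow_update_erase]
  refine principalMinor_erase_of_row (S := (Finset.range (v + 1)).image
    fun u : ℕ => ((Sum.inr (j + 1) : Fin m ⊕ ℕ), (u : ℤ))) _ ?_ ?_ (by simp) fun q hq => ?_
  · simp only [mem_siteWindow, inr_mem_chainPoints, Function.update_self]
    omega
  · simp only [Finset.image_subset_iff, Finset.mem_range, mem_siteWindow, inr_mem_chainPoints,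
      Function.update_of_ne hsucc]
    omega
  · rw [Finset.sum_image fun a _ b _ h => by simpa using h,
      sum_range_chainMatrix_inr_succ hr hr1 j v (mem_siteWindow.1 hq).2.1]

theorem chainDet_update_inr_of_le (hr : 0 < r) {k : Fin m} (ht : t k = T) (hk : 1 ≤ n k)
    (hkN : n k ≤ N) (hcl : ∀ i, k < i → c (Sum.inl i) = 0)
    (hcr : ∀ j, n k < j → c (Sum.inr j) = 0) {v : ℕ} (hv : v + 1 ≤ c (Sum.inl k)) :
    chainDet r R n t N T (Function.update c (Sum.inr (n k)) v) =
      chainDet r R n t N T (Function.update c (Sum.inr (n k)) (v + 1)) := by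
  rw [chainDet, ← siteWindow_update_erase]
  refine principalMinor_erase_of_row (S := {(Sum.inl k, (v : ℤ))}) _ ?_ ?_ (by simp) ?_
  · simp only [mem_siteWindow, inr_mem_chainPoints, Function.update_self]
    omega
  · simp only [Finset.singleton_subset_iff, mem_siteWindow, inl_mem_chainPoints, true_and,
      Function.update_of_ne Sum.inl_ne_inr]
    omega
  · rintro ⟨b, u⟩ hq
    obtain ⟨-, hu, huc⟩ := mem_siteWindow.1 hq
    rw [Finset.sum_singleton, chainMatrix_inl_eq_inr_left hr ht]
    · rintro i rfl
      by_contra! hki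
      rw [Function.update_of_ne Sum.inl_ne_inr, hcl i hki] at huc
      omega
    · rintro j rfl
      by_contra! hkj
      rw [Function.update_of_ne (by simpa using hkj.ne'), hcr j hkj] at huc
      omega

theorem chainDet_update_inl_of_le (hr : 0 < r) {k : Fin m} (ht : t k = T) (hk : 1 ≤ n k)
    (hkN : n k ≤ N) (hcl : ∀ i, k < i → c (Sum.inl i) = 0)
    (hcr : ∀ j, n k < j → c (Sum.inr j) = 0) {v : ℕ} (hv : v + 1 ≤ c (Sum.inr (n k))) :
    chainDet r R n t N T (Function.update c (Sum.inl k) v) =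
      chainDet r R n t N T (Function.update c (Sum.inl k) (v + 1)) := by
  rw [chainDet, ← siteWindow_update_erase]
  refine principalMinor_erase_of_col (S := {(Sum.inr (n k), (v : ℤ))}) _ ?_ ?_ (by simp) ?_
  · simp only [mem_siteWindow, inl_mem_chainPoints, true_and, Function.update_self]
    omega
  · simp only [Finset.singleton_subset_iff, mem_siteWindow, inr_mem_chainPoints,
      Function.update_of_ne Sum.inr_ne_inl]
    omega
  · rintro ⟨b, u⟩ hq
    obtain ⟨-, hu, huc⟩ := mem_siteWindow.1 hq
    rw [Finset.sum_singleton, chainMatrix_inr_eq_inl_right hr ht]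
    · rintro i rfl
      by_contra! hki
      rw [Function.update_of_ne (by simpa using hki.ne'), hcl i hki] at huc
      omega
    · rintro j rfl
      by_contra! hkj
      rw [Function.update_of_ne Sum.inr_ne_inl, hcr j hkj] at huc
      omega

theorem eq_of_forall_eq_succ {β : Type*} {f : ℕ → β} {a b : ℕ} (hab : a ≤ b)
    (h : ∀ v, v + 1 ≤ b → f v = f (v + 1)) : f a = f b := by
  induction b, hab using Nat.le_induction with
  | base => rfl
  | succ b _ ih => exact (ih fun v hv => h v (by omega)).trans (h b le_rfl)

theorem chainDet_transfer (hr : 0 < r) {k : Fin m} (ht : t k = T) (hk : 1 ≤ n k) (hkN : n k ≤ N)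
    (hcl : ∀ i, k < i → c (Sum.inl i) = 0) (hcr : ∀ j, n k < j → c (Sum.inr j) = 0) :
    chainDet r R n t N T c =
      chainDet r R n t N T (Function.update (Function.update c (Sum.inr (n k))
        (max (c (Sum.inr (n k))) (c (Sum.inl k)))) (Sum.inl k) 0) := by
  set c' := Function.update c (Sum.inr (n k)) (max (c (Sum.inr (n k))) (c (Sum.inl k))) with hc'
  have hraise : chainDet r R n t N T c = chainDet r R n t N T c' := by
    rcases le_total (c (Sum.inl k)) (c (Sum.inr (n k))) with h | h
    · rw [hc', max_eq_left h, Function.update_eq_self]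
    · rw [hc', max_eq_right h, ← eq_of_forall_eq_succ h fun v =>
        chainDet_update_inr_of_le hr ht hk hkN hcl hcr, Function.update_eq_self]
  have hinl (i : Fin m) : c' (Sum.inl i) = c (Sum.inl i) :=
    Function.update_of_ne Sum.inl_ne_inr _ _
  have hle : c' (Sum.inl k) ≤ c' (Sum.inr (n k)) := by
    rw [hinl, hc', Function.update_self]
    exact le_max_right _ _
  rw [hraise, eq_of_forall_eq_succ
    (f := fun v => chainDet r R n t N T (Function.update c' (Sum.inl k) v))
    (Nat.zero_le (c' (Sum.inl k))) fun v hv =>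
    chainDet_update_inl_of_le hr ht hk hkN (fun i hi => (hinl i).trans (hcl i hi))
      (fun j hj => (Function.update_of_ne (by simpa using hj.ne') _ _).trans (hcr j hj))
      (hv.trans hle), Function.update_eq_self]

theorem chainDet_zero_eq_zero (hr : 0 < r) (hR : 0 < R) (hcl : ∀ i, c (Sum.inl i) = 0) {j : ℕ}
    (hj : 1 ≤ j) (hjN : j ≤ N) (hc : 0 < c (Sum.inr j))
    (hcr : ∀ i, j < i → i ≤ N → c (Sum.inr i) = 0) : chainDet r R n t N 0 c = 0 := by
  have hmem : ((Sum.inr j : Fin m ⊕ ℕ), (0 : ℤ)) ∈ siteWindow (chainPoints m N) c := by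
    rw [mem_siteWindow, inr_mem_chainPoints]
    omega
  refine Matrix.det_eq_zero_of_column_eq_zero ⟨_, hmem⟩ ?_
  rintro ⟨⟨i | b, u⟩, hp⟩
  · have := mem_siteWindow.1 hp
    rw [hcl] at this
    omega
  · obtain ⟨hb, hu, huc⟩ := mem_siteWindow.1 hp
    refine chainMatrix_zero_inr_zero_right hr hR hj (not_lt.1 fun hjb => ?_) u
    rw [hcr b hjb (inr_mem_chainPoints.1 hb).2] at huc
    omega

theorem chainDet_eq_one (hcl : ∀ i, c (Sum.inl i) = 0)
    (hcr : ∀ j, 1 ≤ j → j ≤ N → c (Sum.inr j) = 0) : chainDet r R n t N T c = 1 := by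
  have hempty : siteWindow (chainPoints m N) c = ∅ := by
    refine Finset.eq_empty_of_forall_notMem ?_
    rintro ⟨i | j, u⟩ hp
    · have := mem_siteWindow.1 hp
      rw [hcl] at this
      omega
    · obtain ⟨hj, hu, huc⟩ := mem_siteWindow.1 hp
      rw [hcr j (inr_mem_chainPoints.1 hj).1 (inr_mem_chainPoints.1 hj).2] at huc
      omega
  rw [chainDet, hempty, principalMinor_empty]

end ChainDet

/-! ### Power series -/

section ExpSeries

variable {a : ℕ → ℝ} {C B : ℝ}

theorem succ_mul_div_factorial_succ (k : ℕ) (y : ℝ) :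
    ((k + 1 : ℕ) : ℝ) * y / ((k + 1).factorial : ℝ) = y / (k.factorial : ℝ) := by
  rw [Nat.factorial_succ, Nat.cast_mul]
  exact mul_div_mul_left _ _ (Nat.cast_ne_zero.2 k.succ_ne_zero)

theorem summable_expSeries (ha : ∀ k, |a k| ≤ C * B ^ k) (τ : ℝ) :
    Summable fun k : ℕ => τ ^ k / (k.factorial : ℝ) * a k := by
  refine .of_norm_bounded ((Real.summable_pow_div_factorial (|τ| * B)).mul_left C) fun k => ?_
  rw [Real.norm_eq_abs, abs_mul, abs_div, abs_pow, Nat.abs_cast, mul_pow]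
  calc |τ| ^ k / (k.factorial : ℝ) * |a k|
      ≤ |τ| ^ k / (k.factorial : ℝ) * (C * B ^ k) := by gcongr; exact ha k
    _ = C * (|τ| ^ k * B ^ k / (k.factorial : ℝ)) := by ring

theorem hasDerivAt_expSeries (ha : ∀ k, |a k| ≤ C * B ^ k) (τ : ℝ) :
    HasDerivAt (fun τ : ℝ => ∑' k : ℕ, τ ^ k / (k.factorial : ℝ) * a k)
      (∑' k : ℕ, τ ^ k / (k.factorial : ℝ) * a (k + 1)) τ := by
  have hterm (k : ℕ) (y : ℝ) : HasDerivAt (fun τ : ℝ => τ ^ k / (k.factorial : ℝ) * a k)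
      (k * y ^ (k - 1) / (k.factorial : ℝ) * a k) y :=
    ((hasDerivAt_pow k y).div_const _).mul_const _
  have ha' (k : ℕ) : |(|a (k + 1)|)| ≤ (C * B) * B ^ k := by
    rw [abs_abs]
    exact (ha (k + 1)).trans_eq (by ring)
  set ρ := |τ| + 1
  let u : ℕ → ℝ := fun k => k * ρ ^ (k - 1) / (k.factorial : ℝ) * |a k|
  have hu : Summable u := by
    rw [← summable_nat_add_iff 1]
    refine (summable_expSeries ha' ρ).congr fun k => ?_
    simp only [u, Nat.add_sub_cancel, succ_mul_div_factorial_succ]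
  have hbound (k : ℕ) (y : ℝ) (hy : y ∈ Metric.ball 0 ρ) :
      ‖k * y ^ (k - 1) / (k.factorial : ℝ) * a k‖ ≤ u k := by
    have hyρ : |y| ≤ ρ := by simpa only [Real.norm_eq_abs] using (mem_ball_zero_iff.1 hy).le
    rw [Real.norm_eq_abs, abs_mul, abs_div, abs_mul, abs_pow, Nat.abs_cast, Nat.abs_cast]
    change _ ≤ k * ρ ^ (k - 1) / (k.factorial : ℝ) * |a k|
    gcongr
  have hτ : τ ∈ Metric.ball 0 ρ := mem_ball_zero_iff.2 (lt_add_one _)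
  refine (hasDerivAt_tsum_of_isPreconnected hu Metric.isOpen_ball
    (convex_ball (0 : ℝ) ρ).isPreconnected (fun k y _ => hterm k y) hbound hτ
    (summable_expSeries ha τ) hτ).congr_deriv ?_
  rw [(Summable.of_norm_bounded hu fun k => hbound k τ hτ).tsum_eq_zero_add]
  simp only [Nat.cast_zero, zero_mul, zero_div, zero_add, Nat.add_sub_cancel,
    succ_mul_div_factorial_succ]

end ExpSeries

theorem eq_exp_mul_of_hasDerivAt {κ : ℂ} {h : ℝ → ℂ} (hd : ∀ τ, HasDerivAt h (κ * h τ) τ)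
    (τ : ℝ) : h τ = Complex.exp (κ * τ) * h 0 := by
  have hE (τ : ℝ) : HasDerivAt (fun τ : ℝ => Complex.exp (-κ * τ)) (Complex.exp (-κ * τ) * -κ) τ :=
    ((Complex.ofRealCLM.hasDerivAt.const_mul (-κ)).cexp).congr_deriv (by simp)
  have hconst (τ : ℝ) : HasDerivAt (fun τ : ℝ => Complex.exp (-κ * τ) * h τ) 0 τ :=
    ((hE τ).mul (hd τ)).congr_deriv (by ring)
  have h0 := is_const_of_deriv_eq_zero (fun τ => (hconst τ).differentiableAt)
    (fun τ => (hconst τ).deriv) τ 0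
  simp only [Complex.ofReal_zero, mul_zero, Complex.exp_zero, one_mul] at h0
  rw [← h0, ← mul_assoc, ← Complex.exp_add, neg_mul, add_neg_cancel, Complex.exp_zero, one_mul]

/-! ### The evolution equation on constraints -/

/-- The constraints `c`, one for every label `j ≥ 1`, that decrease weakly in the label and vanish
for the labels `j > ν`. The value `c 0` plays no role. -/
def IsAntitoneConstraint (ν : ℕ) (c : ℕ → ℕ) : Prop :=
  (∀ j, ν < j → c j = 0) ∧ ∀ j, 1 ≤ j → c (j + 1) ≤ c j

/-- The generator of TASEP in terms of constraints on the labels `1, …, N`: at rate `1` the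
constraint on a label is lowered by one, provided that it exceeds the constraint on the next
label. -/
def constraintGenerator {E : Type*} [AddCommGroup E] (N : ℕ) (F : (ℕ → ℕ) → E) (c : ℕ → ℕ) : E :=
  ∑ j ∈ Finset.Icc 1 N, if c (j + 1) < c j then F (Function.update c j (c j - 1)) - F c else 0

/-- The semigroup `e^{τG} F = ∑ₖ (τᵏ / k!) Gᵏ F` of `G = constraintGenerator N`. -/
noncomputable def constraintSemigroup (N : ℕ) (τ : ℝ) (F : (ℕ → ℕ) → ℝ) (c : ℕ → ℕ) : ℝ :=
  ∑' k : ℕ, τ ^ k / (k.factorial : ℝ) * (constraintGenerator N)^[k] F c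

/-- `F` does not see whether the constraint on a label `j < N` is spelled out when it follows, in
strictly ordered configurations, from the constraint on the label `j + 1`. -/
def RespectsOrder {E : Type*} (N : ℕ) (F : (ℕ → ℕ) → E) : Prop :=
  ∀ ⦃c : ℕ → ℕ⦄ ⦃j v : ℕ⦄, 1 ≤ j → j + 1 ≤ N → v + 1 ≤ c (j + 1) →
    F (Function.update c j v) = F (Function.update c j (v + 1))

section Constraint

variable {N ν : ℕ} {c : ℕ → ℕ}

theorem IsAntitoneConstraint.mono (hc : IsAntitoneConstraint ν c) (hν : ν ≤ N) :
    IsAntitoneConstraint N c :=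
  ⟨fun j hj => hc.1 j (hν.trans_lt hj), hc.2⟩

theorem IsAntitoneConstraint.le_of_le (hc : IsAntitoneConstraint ν c) {i j : ℕ} (hi : 1 ≤ i)
    (hij : i ≤ j) : c j ≤ c i := by
  induction j, hij using Nat.le_induction with
  | base => rfl
  | succ k hk ih => exact (hc.2 k (hi.trans hk)).trans ih

theorem IsAntitoneConstraint.update_sub_one (hc : IsAntitoneConstraint ν c) {j : ℕ}
    (hlt : c (j + 1) < c j) : IsAntitoneConstraint ν (Function.update c j (c j - 1)) := by
  have hle : Function.update c j (c j - 1) ≤ c := update_le_self_iff.2 (Nat.sub_le _ _)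
  refine ⟨fun i hi => Nat.le_zero.1 ((hle i).trans_eq (hc.1 i hi)), fun i hi => ?_⟩
  rcases eq_or_ne i j with rfl | hij
  · rw [Function.update_self, Function.update_of_ne (Nat.succ_ne_self i)]
    exact Nat.le_sub_one_of_lt hlt
  · rw [Function.update_of_ne hij]
    exact (hle _).trans (hc.2 i hi)

section AddCommGroup

variable {E E' : Type*} [AddCommGroup E] [AddCommGroup E'] {F F' : (ℕ → ℕ) → E}

theorem constraintGenerator_congr (h : ∀ c, IsAntitoneConstraint ν c → F c = F' c)
    (hc : IsAntitoneConstraint ν c) : constraintGenerator N F c = constraintGenerator N F' c := by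
  refine Finset.sum_congr rfl fun j _ => ?_
  split_ifs with hlt
  · rw [h _ (hc.update_sub_one hlt), h c hc]
  · rfl

theorem iterate_constraintGenerator_congr (h : ∀ c, IsAntitoneConstraint ν c → F c = F' c) (k : ℕ)
    (hc : IsAntitoneConstraint ν c) :
    (constraintGenerator N)^[k] F c = (constraintGenerator N)^[k] F' c := by
  induction k generalizing c with
  | zero => exact h c hc
  | succ k ih =>
    simp only [Function.iterate_succ_apply']
    exact constraintGenerator_congr (fun c hc => ih hc) hc

theorem map_constraintGenerator (φ : E →+ E') (F : (ℕ → ℕ) → E) (c : ℕ → ℕ) :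
    φ (constraintGenerator N F c) = constraintGenerator N (fun c => φ (F c)) c := by
  simp only [constraintGenerator, map_sum, apply_ite φ, map_sub, map_zero]

theorem constraintGenerator_sub :
    constraintGenerator N (fun c => F c - F' c) c =
      constraintGenerator N F c - constraintGenerator N F' c := by
  rw [constraintGenerator, constraintGenerator, constraintGenerator, ← Finset.sum_sub_distrib]
  refine Finset.sum_congr rfl fun j _ => ?_
  split_ifs
  · abel
  · rw [sub_zero]

theorem constraintGenerator_zero :
    constraintGenerator N (fun _ => (0 : E)) c = 0 := by
  simp only [constraintGenerator, sub_self, ite_self, Finset.sum_const_zero]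

theorem constraintGenerator_sum {ι : Type*} (S : Finset ι) (F : ι → (ℕ → ℕ) → E) :
    constraintGenerator N (fun c => ∑ i ∈ S, F i c) c =
      ∑ i ∈ S, constraintGenerator N (F i) c := by
  simp only [constraintGenerator]
  rw [Finset.sum_comm]
  refine Finset.sum_congr rfl fun j _ => ?_
  split_ifs
  · exact (Finset.sum_sub_distrib _ _).symm
  · exact Finset.sum_const_zero.symm

theorem constraintGenerator_zero_right (F : (ℕ → ℕ) → E) : constraintGenerator N F 0 = 0 :=
  Finset.sum_eq_zero fun _ _ => if_neg (lt_irrefl 0)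

theorem RespectsOrder.constraintGenerator_eq_sum (hF : RespectsOrder N F)
    (hc : IsAntitoneConstraint N c) : constraintGenerator N F c =
      ∑ j ∈ Finset.Icc 1 N, (F (Function.update c j (c j - 1)) - F c) := by
  refine Finset.sum_congr rfl fun j hj => ?_
  split_ifs with hlt
  · rfl
  rw [eq_comm, sub_eq_zero]
  rcases Nat.eq_zero_or_pos (c j) with h0 | h0
  · rw [Function.update_eq_self_iff.2 (by omega)]
  · have hj1 := (Finset.mem_Icc.1 hj).1
    have hjN : j + 1 ≤ N := by
      by_contra! hNj
      have := hc.1 (j + 1) hNj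
      omega
    have h := hF hj1 hjN (show c j - 1 + 1 ≤ c (j + 1) by omega)
    rwa [Nat.sub_add_cancel h0, Function.update_eq_self] at h

end AddCommGroup

theorem RespectsOrder.eq_of_forall_isAntitoneConstraint {E : Type*} {F F' : (ℕ → ℕ) → E}
    (hF : RespectsOrder N F) (hF' : RespectsOrder N F') (hν : ν ≤ N)
    (h : ∀ c, IsAntitoneConstraint ν c → F c = F' c) (hc : ∀ j, ν < j → c j = 0) :
    F c = F' c := by
  obtain ⟨B, hB⟩ : ∃ B, ∀ j, 1 ≤ j → c j ≤ B := by
    refine ⟨∑ j ∈ Finset.Icc 1 ν, c j, fun j hj => ?_⟩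
    by_cases hjν : j ≤ ν
    · exact Finset.single_le_sum (fun _ _ => Nat.zero_le _) (Finset.mem_Icc.2 ⟨hj, hjν⟩)
    · exact (hc j (not_le.1 hjν)).trans_le (Nat.zero_le _)
  induction hs : ∑ j ∈ Finset.Icc 1 ν, (B - c j) using Nat.strong_induction_on
    generalizing c with
  | _ s ih =>
    by_cases hanti : ∀ j, 1 ≤ j → c (j + 1) ≤ c j
    · exact h c ⟨hc, hanti⟩
    push Not at hanti
    obtain ⟨j, hj, hlt⟩ := hanti
    have hjν : j + 1 ≤ ν := by
      by_contra! hνj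
      have := hc (j + 1) hνj
      omega
    have hBj := hB (j + 1) (by omega)
    have hraise {G : (ℕ → ℕ) → E} (hG : RespectsOrder N G) :
        G c = G (Function.update c j (c j + 1)) := by
      rw [← hG hj (hjν.trans hν) hlt, Function.update_eq_self]
    rw [hraise hF, hraise hF']
    have hsum : ∑ i ∈ Finset.Icc 1 ν, (B - Function.update c j (c j + 1) i) < s := by
      have hle : c ≤ Function.update c j (c j + 1) := le_update_self_iff.2 (Nat.le_succ _)
      refine hs ▸ Finset.sum_lt_sum (fun i _ => Nat.sub_le_sub_left (hle i) B)
        ⟨j, Finset.mem_Icc.2 ⟨hj, by omega⟩, ?_⟩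
      rw [Function.update_self]
      omega
    refine ih _ hsum (fun i hi => ?_) (fun i hi => ?_) rfl
    · rw [Function.update_of_ne (by omega)]
      exact hc i hi
    · rcases eq_or_ne i j with rfl | hij
      · rw [Function.update_self]
        omega
      · rw [Function.update_of_ne hij]
        exact hB i hi

section Real

variable {F : (ℕ → ℕ) → ℝ} {C : ℝ}

theorem abs_constraintGenerator_le (hF : ∀ c, |F c| ≤ C) (c : ℕ → ℕ) :
    |constraintGenerator N F c| ≤ 2 * N * C := by
  have hC : 0 ≤ C := (abs_nonneg _).trans (hF c)
  calc |constraintGenerator N F c|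
      ≤ ∑ j ∈ Finset.Icc 1 N, 2 * C := by
        refine (Finset.abs_sum_le_sum_abs _ _).trans (Finset.sum_le_sum fun j _ => ?_)
        split_ifs
        · refine (abs_sub _ _).trans ?_
          linarith [hF c, hF (Function.update c j (c j - 1))]
        · simpa only [abs_zero] using mul_nonneg zero_le_two hC
    _ = 2 * N * C := by
        rw [Finset.sum_const, Nat.card_Icc, nsmul_eq_mul, Nat.add_sub_cancel]
        ring

theorem abs_iterate_constraintGenerator_le (hF : ∀ c, |F c| ≤ C) (k : ℕ) (c : ℕ → ℕ) :
    |(constraintGenerator N)^[k] F c| ≤ C * (2 * N) ^ k := by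
  induction k generalizing c with
  | zero => simpa only [Function.iterate_zero_apply, pow_zero, mul_one] using hF c
  | succ k ih =>
    rw [Function.iterate_succ_apply']
    exact (abs_constraintGenerator_le ih c).trans_eq (by ring)

theorem hasSum_constraintGenerator {F : ℕ → (ℕ → ℕ) → ℝ} {S : (ℕ → ℕ) → ℝ}
    (h : ∀ c, HasSum (fun k => F k c) (S c)) (c : ℕ → ℕ) :
    HasSum (fun k => constraintGenerator N (F k) c) (constraintGenerator N S c) := by
  refine hasSum_sum fun j _ => ?_
  split_ifs
  · exact (h _).sub (h c)
  · exact hasSum_zero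

theorem constraintSemigroup_zero_left (F : (ℕ → ℕ) → ℝ) (c : ℕ → ℕ) :
    constraintSemigroup N 0 F c = F c := by
  rw [constraintSemigroup, tsum_eq_single 0 fun k hk => by rw [zero_pow hk, zero_div, zero_mul]]
  simp

theorem constraintSemigroup_zero_right (τ : ℝ) (F : (ℕ → ℕ) → ℝ) :
    constraintSemigroup N τ F 0 = F 0 := by
  rw [constraintSemigroup, tsum_eq_single 0]
  · simp
  · intro k hk
    obtain ⟨k, rfl⟩ := Nat.exists_eq_succ_of_ne_zero hk
    rw [Function.iterate_succ_apply', constraintGenerator_zero_right, mul_zero]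

theorem hasDerivAt_constraintSemigroup (hF : ∀ c, |F c| ≤ C) (c : ℕ → ℕ) (τ : ℝ) :
    HasDerivAt (fun τ => constraintSemigroup N τ F c)
      (constraintGenerator N (constraintSemigroup N τ F) c) τ := by
  have hbound (c : ℕ → ℕ) (k : ℕ) := abs_iterate_constraintGenerator_le (N := N) hF k c
  refine (hasDerivAt_expSeries (hbound c) τ).congr_deriv (HasSum.tsum_eq ?_)
  refine (hasSum_constraintGenerator
    (fun c => (summable_expSeries (hbound c) τ).hasSum) c).congr_fun fun k => ?_
  rw [Function.iterate_succ_apply']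
  exact map_constraintGenerator (AddMonoidHom.mulLeft (τ ^ k / (k.factorial : ℝ))) _ c

end Real

theorem eq_zero_of_hasDerivAt_constraintGenerator {H : (ℕ → ℕ) → ℝ → ℂ}
    (h0 : ∀ c, IsAntitoneConstraint ν c → H c 0 = 0)
    (hH : ∀ c, IsAntitoneConstraint ν c → ∀ τ,
      HasDerivAt (H c) (constraintGenerator N (fun c => H c τ) c) τ)
    (hc : IsAntitoneConstraint ν c) (τ : ℝ) : H c τ = 0 := by
  induction hs : ∑ j ∈ Finset.Icc 1 N, c j using Nat.strong_induction_on generalizing c τ with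
  | _ s ih =>
    have hlow (τ : ℝ) (j : ℕ) (hj : j ∈ Finset.Icc 1 N) (hlt : c (j + 1) < c j) :
        H (Function.update c j (c j - 1)) τ = 0 := by
      refine ih _ (hs ▸ ?_) (hc.update_sub_one hlt) τ rfl
      have hle : Function.update c j (c j - 1) ≤ c := update_le_self_iff.2 (Nat.sub_le _ _)
      refine Finset.sum_lt_sum (fun i _ => hle i) ⟨j, hj, ?_⟩
      rw [Function.update_self]
      omega
    set κ : ℂ := ∑ j ∈ Finset.Icc 1 N, if c (j + 1) < c j then -1 else 0
    have hd (τ : ℝ) : HasDerivAt (H c) (κ * H c τ) τ := by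
      refine (hH c hc τ).congr_deriv ?_
      rw [constraintGenerator, Finset.sum_mul]
      refine Finset.sum_congr rfl fun j hj => ?_
      split_ifs with hlt
      · rw [hlow τ j hj hlt, zero_sub, neg_one_mul]
      · rw [zero_mul]
    rw [eq_exp_mul_of_hasDerivAt hd, h0 c hc, mul_zero]

theorem eq_of_hasDerivAt_constraintGenerator {H H' : (ℕ → ℕ) → ℝ → ℂ}
    (h0 : ∀ c, IsAntitoneConstraint ν c → H c 0 = H' c 0)
    (hH : ∀ c, IsAntitoneConstraint ν c → ∀ τ,
      HasDerivAt (H c) (constraintGenerator N (fun c => H c τ) c) τ)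
    (hH' : ∀ c, IsAntitoneConstraint ν c → ∀ τ,
      HasDerivAt (H' c) (constraintGenerator N (fun c => H' c τ) c) τ)
    (hc : IsAntitoneConstraint ν c) (τ : ℝ) : H c τ = H' c τ := by
  refine sub_eq_zero.1 (eq_zero_of_hasDerivAt_constraintGenerator (N := N)
    (H := fun c τ => H c τ - H' c τ) (fun c hc => sub_eq_zero.2 (h0 c hc)) (fun c hc τ => ?_) hc τ)
  exact ((hH c hc τ).sub (hH' c hc τ)).congr_deriv constraintGenerator_sub.symm

end Constraint

/-! ### Constraints on the particles -/

/-- The strictly decreasing configurations in which every particle `n` is at or to the right of its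
initial position `-n`. TASEP with step initial condition never leaves this set. -/
def stepStates : Set (ℕ+ → ℤ) := {x | StrictAnti x ∧ ∀ n : ℕ+, -((n : ℕ) : ℤ) ≤ x n}

/-- The labels `1, …, N`. -/
def firstLabels (N : ℕ) : Finset ℕ+ := (Finset.range N).map ⟨Nat.succPNat, Nat.succPNat_injective⟩

/-- The configurations in which every particle `n ≤ N` is at least `c n` steps to the right of its
initial position `-n`. -/
def constraintRegion (N : ℕ) (c : ℕ → ℕ) : Set (ℕ+ → ℤ) :=
  {x | ∀ n : ℕ+, (n : ℕ) ≤ N → (c n : ℤ) ≤ x n + (n : ℕ)}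

section Configuration

variable {N : ℕ} {c : ℕ → ℕ} {x : ℕ+ → ℤ} {n : ℕ+}

theorem update_mem_stepStates (hx : x ∈ stepStates) (hn : ∀ j, x j ≠ x n + 1) :
    Function.update x n (x n + 1) ∈ stepStates := by
  have hle : x ≤ Function.update x n (x n + 1) := le_update_self_iff.2 (by omega)
  refine ⟨fun a b hab => ?_, fun k => (hx.2 k).trans (hle k)⟩
  have hx_lt := hx.1 hab
  rcases eq_or_ne b n with rfl | hb
  · have := hn a
    rw [Function.update_self, Function.update_of_ne hab.ne]
    omega
  · rw [Function.update_of_ne hb]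
    exact hx_lt.trans_le (hle a)

theorem tasepGenerator_congr {f g : (ℕ+ → ℤ) → ℝ} (h : ∀ x ∈ stepStates, f x = g x)
    (hx : x ∈ stepStates) : tasepGenerator f x = tasepGenerator g x := by
  refine tsum_congr fun n => ?_
  split_ifs with hn
  · rw [h x hx, h _ (update_mem_stepStates hx hn)]
  · rfl

theorem mem_firstLabels : n ∈ firstLabels N ↔ (n : ℕ) ≤ N := by
  refine Finset.mem_map.trans ⟨?_, fun h => ⟨n.natPred, ?_, PNat.succPNat_natPred n⟩⟩
  · rintro ⟨k, hk, rfl⟩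
    exact Finset.mem_range.1 hk
  · have := n.natPred_add_one
    rw [Finset.mem_range]
    omega

theorem sum_firstLabels {E : Type*} [AddCommMonoid E] (N : ℕ) (f : ℕ → E) :
    ∑ n ∈ firstLabels N, f n = ∑ j ∈ Finset.Icc 1 N, f j := by
  simp only [firstLabels, Finset.sum_map, Function.Embedding.coeFn_mk, Nat.succPNat_coe,
    Nat.succ_eq_add_one]
  rw [Finset.range_eq_Ico, Finset.sum_Ico_add' f 0 N 1, zero_add, Finset.Ico_add_one_right_eq_Icc]

open Classical in
theorem tasepGenerator_eq_sum {f : (ℕ+ → ℤ) → ℝ} {S : Finset ℕ+}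
    (hf : DependsOn f (S : Set ℕ+)) (x : ℕ+ → ℤ) :
    tasepGenerator f x = ∑ n ∈ S,
      if ∀ j, x j ≠ x n + 1 then f (Function.update x n (x n + 1)) - f x else 0 := by
  refine tsum_eq_sum fun n hn => ?_
  split_ifs
  · refine sub_eq_zero.2 (hf fun i hi => Function.update_of_ne ?_ _ _)
    rintro rfl
    exact hn hi
  · rfl

theorem tasepGenerator_constraintGenerator {F : (ℕ → ℕ) → (ℕ+ → ℤ) → ℝ} {S : Finset ℕ+}
    (hF : ∀ c, DependsOn (F c) (S : Set ℕ+)) (c : ℕ → ℕ) (x : ℕ+ → ℤ) :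
    tasepGenerator (fun y => constraintGenerator N (fun c => F c y) c) x =
      constraintGenerator N (fun c => tasepGenerator (F c) x) c := by
  classical
  have hG : DependsOn (fun y => constraintGenerator N (fun c => F c y) c) (S : Set ℕ+) :=
    fun y z hyz => by simp only [fun c => hF c hyz]
  simp only [tasepGenerator_eq_sum hG, tasepGenerator_eq_sum (hF _), constraintGenerator_sum]
  refine Finset.sum_congr rfl fun n _ => ?_
  split_ifs
  · exact constraintGenerator_sub.symm
  · exact constraintGenerator_zero.symm

theorem tasepGenerator_iterate_constraintGenerator {F : (ℕ → ℕ) → (ℕ+ → ℤ) → ℝ} {S : Finset ℕ+}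
    (hF : ∀ c, DependsOn (F c) (S : Set ℕ+)) (k : ℕ) (c : ℕ → ℕ) (x : ℕ+ → ℤ) :
    tasepGenerator (fun y => (constraintGenerator N)^[k] (fun c => F c y) c) x =
      (constraintGenerator N)^[k] (fun c => tasepGenerator (F c) x) c := by
  induction k generalizing c with
  | zero => rfl
  | succ k ih =>
    simp only [Function.iterate_succ_apply']
    rw [tasepGenerator_constraintGenerator (S := S)
      (F := fun c y => (constraintGenerator N)^[k] (fun c => F c y) c)
      fun c y z hyz => by simp only [fun c => hF c hyz]]
    simp only [ih]

theorem update_mem_constraintRegion_iff (hx : 0 ≤ x n + (n : ℕ)) :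
    Function.update x n (x n + 1) ∈ constraintRegion N c ↔
      x ∈ constraintRegion N (Function.update c n (c n - 1)) := by
  refine forall_congr' fun k => imp_congr_right fun _ => ?_
  rcases eq_or_ne k n with rfl | hk
  · rw [Function.update_self, Function.update_self]
    omega
  · rw [Function.update_of_ne hk, Function.update_of_ne (PNat.coe_injective.ne hk)]

theorem mem_constraintRegion_update_sub_one_iff (hc : IsAntitoneConstraint N c)
    (hx : StrictAnti x) (hn : ∃ i, x i = x n + 1) :
    x ∈ constraintRegion N (Function.update c n (c n - 1)) ↔ x ∈ constraintRegion N c := by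
  obtain ⟨i, hi⟩ := hn
  have hin : (i : ℕ) < n := hx.lt_iff_gt.1 (by omega)
  refine ⟨fun h k hk => ?_, fun h k hk => le_trans ?_ (h k hk)⟩
  · have hxk := h k hk
    rcases eq_or_ne k n with rfl | hkn
    · have hxi := h i (by omega)
      have hci := hc.le_of_le i.pos hin.le
      rw [Function.update_of_ne hin.ne] at hxi
      omega
    · rwa [Function.update_of_ne (PNat.coe_injective.ne hkn)] at hxk
  · have hle : Function.update c n (c n - 1) ≤ c := update_le_self_iff.2 (Nat.sub_le _ _)
    exact_mod_cast hle k

theorem mem_constraintRegion_update_iff (hx : StrictAnti x) {j v : ℕ} (hj : 1 ≤ j)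
    (hjN : j + 1 ≤ N) (hv : v + 1 ≤ c (j + 1)) :
    x ∈ constraintRegion N (Function.update c j v) ↔
      x ∈ constraintRegion N (Function.update c j (v + 1)) := by
  lift j to ℕ+ using hj
  refine ⟨fun h k hk => ?_, fun h k hk => le_trans ?_ (h k hk)⟩
  · rcases eq_or_ne k j with rfl | hkj
    · have hnext := h (k + 1) (by simpa using hjN)
      have hxk := hx (PNat.lt_add_right k 1)
      rw [PNat.add_coe, PNat.one_coe, Function.update_of_ne (Nat.succ_ne_self _)] at hnext
      rw [Function.update_self]
      simp only [Nat.succ_eq_add_one] at hnext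
      omega
    · have hxk := h k hk
      rwa [Function.update_of_ne (PNat.coe_injective.ne hkj)] at hxk ⊢
  · have hle : Function.update c j v ≤ Function.update c j (v + 1) :=
      update_le_update_iff'.2 (Nat.le_succ v)
    exact_mod_cast hle k

end Configuration

/-- The indicator of `constraintRegion N c`. -/
noncomputable def constraintInd (N : ℕ) (c : ℕ → ℕ) : (ℕ+ → ℤ) → ℝ :=
  (constraintRegion N c).indicator 1

section ConstraintInd

variable {N : ℕ} {c : ℕ → ℕ} {x : ℕ+ → ℤ}

theorem constraintInd_congr {N' : ℕ} {c' : ℕ → ℕ} {y : ℕ+ → ℤ}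
    (h : x ∈ constraintRegion N c ↔ y ∈ constraintRegion N' c') :
    constraintInd N c x = constraintInd N' c' y := by
  classical
  simp only [constraintInd, Set.indicator_apply, h, Pi.one_apply]

theorem respectsOrder_constraintInd (hx : StrictAnti x) :
    RespectsOrder N fun c => constraintInd N c x :=
  fun _ _ _ hj hjN hv => constraintInd_congr (mem_constraintRegion_update_iff hx hj hjN hv)

theorem dependsOn_constraintInd (N : ℕ) (c : ℕ → ℕ) :
    DependsOn (constraintInd N c) (firstLabels N : Set ℕ+) := fun x y h =>
  constraintInd_congr <| forall_congr' fun n => forall_congr' fun hn => by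
    rw [h n (mem_firstLabels.2 hn)]

theorem abs_constraintInd_le_one (N : ℕ) (c : ℕ → ℕ) (x : ℕ+ → ℤ) : |constraintInd N c x| ≤ 1 :=
  (norm_indicator_le_norm_self (1 : (ℕ+ → ℤ) → ℝ) x).trans_eq norm_one

theorem measurableSet_constraintRegion (N : ℕ) (c : ℕ → ℕ) :
    MeasurableSet (constraintRegion N c) := by
  simp only [constraintRegion, Set.ofPred_forall]
  exact .iInter fun n => .iInter fun _ =>
    measurableSet_le measurable_const ((measurable_pi_apply n).add_const _)

theorem measurable_constraintInd (N : ℕ) (c : ℕ → ℕ) : Measurable (constraintInd N c) :=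
  measurable_one.indicator (measurableSet_constraintRegion N c)

theorem tasepGenerator_constraintInd (hc : IsAntitoneConstraint N c) (hx : x ∈ stepStates) :
    tasepGenerator (constraintInd N c) x =
      constraintGenerator N (fun c => constraintInd N c x) c := by
  classical
  rw [tasepGenerator_eq_sum (dependsOn_constraintInd N c),
    (respectsOrder_constraintInd hx.1).constraintGenerator_eq_sum hc, ← sum_firstLabels]
  refine Finset.sum_congr rfl fun n _ => ?_
  split_ifs with hn
  · have := hx.2 n
    rw [constraintInd_congr (update_mem_constraintRegion_iff (by omega))]
  · push Not at hn
    rw [constraintInd_congr (mem_constraintRegion_update_sub_one_iff hc hx.1 hn), sub_self]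

theorem iterate_tasepGenerator_constraintInd (k : ℕ) (hc : IsAntitoneConstraint N c)
    (hx : x ∈ stepStates) : tasepGenerator^[k] (constraintInd N c) x =
      (constraintGenerator N)^[k] (fun c => constraintInd N c x) c := by
  induction k generalizing x with
  | zero => rfl
  | succ k ih =>
    rw [Function.iterate_succ_apply', tasepGenerator_congr (fun y hy => ih hy) hx,
      tasepGenerator_iterate_constraintGenerator (dependsOn_constraintInd N),
      iterate_constraintGenerator_congr (fun c hc => tasepGenerator_constraintInd hc hx) k hc,
      Function.iterate_succ_apply]

theorem tasepSemigroup_constraintInd (τ : ℝ≥0) (hc : IsAntitoneConstraint N c)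
    (hx : x ∈ stepStates) : tasepSemigroup τ (constraintInd N c) x =
      constraintSemigroup N τ (fun c => constraintInd N c x) c :=
  tsum_congr fun k => by rw [iterate_tasepGenerator_constraintInd k hc hx]

end ConstraintInd

/-! ### Constraints on the process -/

section IntegralConstraint

variable {α : Type*} [MeasurableSpace α] {μ : Measure α} {N : ℕ} {F : (ℕ → ℕ) → α → ℝ}

theorem integrable_constraintGenerator (hF : ∀ c, Integrable (F c) μ) (c : ℕ → ℕ) :
    Integrable (fun x => constraintGenerator N (fun c => F c x) c) μ := by
  refine integrable_finsetSum _ fun j _ => ?_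
  split_ifs
  · exact (hF _).sub (hF c)
  · exact integrable_zero _ _ _

theorem integral_constraintGenerator (hF : ∀ c, Integrable (F c) μ) (c : ℕ → ℕ) :
    ∫ x, constraintGenerator N (fun c => F c x) c ∂μ =
      constraintGenerator N (fun c => ∫ x, F c x ∂μ) c := by
  have hterm (j : ℕ) : Integrable (fun x => if c (j + 1) < c j then
      F (Function.update c j (c j - 1)) x - F c x else 0) μ := by
    split_ifs
    · exact (hF _).sub (hF c)
    · exact integrable_zero _ _ _
  simp only [constraintGenerator]
  rw [integral_finsetSum _ fun j _ => hterm j]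
  refine Finset.sum_congr rfl fun j _ => ?_
  split_ifs
  · exact integral_sub (hF _) (hF c)
  · exact integral_zero _ _

theorem integrable_iterate_constraintGenerator (hF : ∀ c, Integrable (F c) μ) (k : ℕ)
    (c : ℕ → ℕ) :
    Integrable (fun x => (constraintGenerator N)^[k] (fun c => F c x) c) μ := by
  induction k generalizing c with
  | zero => exact hF c
  | succ k ih =>
    simp only [Function.iterate_succ_apply']
    exact integrable_constraintGenerator ih c

theorem integral_iterate_constraintGenerator (hF : ∀ c, Integrable (F c) μ) (k : ℕ)
    (c : ℕ → ℕ) :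
    ∫ x, (constraintGenerator N)^[k] (fun c => F c x) c ∂μ =
      (constraintGenerator N)^[k] (fun c => ∫ x, F c x ∂μ) c := by
  induction k generalizing c with
  | zero => rfl
  | succ k ih =>
    simp only [Function.iterate_succ_apply']
    rw [integral_constraintGenerator
      (F := fun c x => (constraintGenerator N)^[k] (fun c => F c x) c)
      fun c => integrable_iterate_constraintGenerator hF k c]
    simp only [ih]

theorem integral_constraintSemigroup [IsFiniteMeasure μ] {C : ℝ} (hF : ∀ c, Integrable (F c) μ)
    (hC : ∀ c x, |F c x| ≤ C) (τ : ℝ) (c : ℕ → ℕ) :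
    ∫ x, constraintSemigroup N τ (fun c => F c x) c ∂μ =
      constraintSemigroup N τ (fun c => ∫ x, F c x ∂μ) c := by
  have hintegrable (k : ℕ) := integrable_iterate_constraintGenerator (N := N) hF k c
  have hnorm (k : ℕ) : |∫ x, ‖(constraintGenerator N)^[k] (fun c => F c x) c‖ ∂μ| ≤
      (C * μ.real Set.univ) * (2 * N) ^ k := by
    refine (norm_integral_le_of_norm_le_const (μ := μ)
      (f := fun x => ‖(constraintGenerator N)^[k] (fun c => F c x) c‖)
      (C := C * (2 * N) ^ k) (.of_forall fun x => ?_)).trans_eq (mul_right_comm _ _ _)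
    rw [norm_norm]
    exact abs_iterate_constraintGenerator_le (fun c => hC c x) k c
  simp only [constraintSemigroup]
  rw [← integral_tsum_of_summable_integral_norm fun k => (hintegrable k).const_mul _]
  · simp only [integral_const_mul, integral_iterate_constraintGenerator hF]
  · refine (summable_expSeries hnorm |τ|).congr fun k => ?_
    simp only [norm_mul, norm_div, norm_pow, Real.norm_eq_abs, Nat.abs_cast]
    rw [integral_const_mul]

end IntegralConstraint

theorem measurable_tasepPast {Ω : Type*} {X : ℝ≥0 → Ω → (ℕ+ → ℤ)} {r s : ℝ≥0} (hrs : r ≤ s) :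
    Measurable[tasepPast X s] (X r) :=
  measurable_iff_comap_le.2 (le_iSup₂_of_le r hrs le_rfl)

section StepProcess

variable {Ω : Type*} [MeasurableSpace Ω] {μ : Measure Ω}
  {X : ℝ≥0 → Ω → (ℕ+ → ℤ)} {N : ℕ} {c : ℕ → ℕ} {A : Set Ω} {s : ℝ≥0}

theorem IsStepTASEP.tasepPast_le (hX : IsStepTASEP μ X) (s : ℝ≥0) :
    tasepPast X s ≤ ‹MeasurableSpace Ω› :=
  iSup_le fun r => iSup_le fun _ => (hX.measurable r).comap_le

theorem setIntegral_constraintInd (hXs : Measurable (X s)) (N : ℕ) (c : ℕ → ℕ) (A : Set Ω) :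
    ∫ ω in A, constraintInd N c (X s ω) ∂μ = μ.real (A ∩ X s ⁻¹' constraintRegion N c) := by
  have hms := hXs (measurableSet_constraintRegion N c)
  rw [Set.inter_comm, ← measureReal_restrict_apply hms, ← integral_indicator_one hms]
  rfl

theorem IsStepTASEP.ae_initial_mem_stepStates (hX : IsStepTASEP μ X) :
    ∀ᵐ ω ∂μ, X 0 ω ∈ stepStates := by
  filter_upwards [hX.initial, hX.ordered 0] with ω hinit hanti
  exact ⟨hanti, fun n => (hinit n).ge⟩

theorem IsStepTASEP.respectsOrder_measureReal_inter (hX : IsStepTASEP μ X) (T : ℝ≥0) (N : ℕ)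
    (A : Set Ω) : RespectsOrder N fun c => μ.real (A ∩ X T ⁻¹' constraintRegion N c) := by
  intro c j v hj hjN hv
  refine measureReal_congr ?_
  filter_upwards [hX.ordered T] with ω hω
  exact propext (and_congr_right fun _ => mem_constraintRegion_update_iff hω hj hjN hv)

variable [IsProbabilityMeasure μ]

theorem IsStepTASEP.setIntegral_markov (hX : IsStepTASEP μ X) (τ : ℝ≥0) {f : (ℕ+ → ℤ) → ℝ}
    (hf : ∃ S : Finset ℕ+, DependsOn f (S : Set ℕ+)) {C : ℝ} (hC : ∀ x, |f x| ≤ C)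
    (hfm : Measurable f) (hA : MeasurableSet[tasepPast X s] A) :
    ∫ ω in A, f (X (s + τ) ω) ∂μ = ∫ ω in A, tasepSemigroup τ f (X s ω) ∂μ := by
  have hle := hX.tasepPast_le s
  have hintegrable : Integrable (fun ω => f (X (s + τ) ω)) μ :=
    .of_bound (hfm.comp (hX.measurable _)).aestronglyMeasurable C (.of_forall fun ω => hC _)
  rw [← setIntegral_condExp hle hintegrable hA]
  exact setIntegral_congr_ae (hle _ hA) ((hX.markov s τ f hf ⟨C, hC⟩).mono fun ω h _ => h)

theorem IsStepTASEP.measureReal_inter_add (hX : IsStepTASEP μ X)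
    (hs : ∀ᵐ ω ∂μ, X s ω ∈ stepStates) (τ : ℝ≥0) (hc : IsAntitoneConstraint N c)
    (hA : MeasurableSet[tasepPast X s] A) :
    μ.real (A ∩ X (s + τ) ⁻¹' constraintRegion N c) =
      constraintSemigroup N τ (fun c => μ.real (A ∩ X s ⁻¹' constraintRegion N c)) c := by
  have hintegrable (c : ℕ → ℕ) : Integrable (fun ω => constraintInd N c (X s ω)) (μ.restrict A) :=
    .of_bound ((measurable_constraintInd N c).comp (hX.measurable s)).aestronglyMeasurable 1
      (.of_forall fun ω => abs_constraintInd_le_one N c _)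
  calc μ.real (A ∩ X (s + τ) ⁻¹' constraintRegion N c)
      = ∫ ω in A, tasepSemigroup τ (constraintInd N c) (X s ω) ∂μ := by
        rw [← setIntegral_constraintInd (hX.measurable _)]
        exact hX.setIntegral_markov τ ⟨_, dependsOn_constraintInd N c⟩
          (abs_constraintInd_le_one N c) (measurable_constraintInd N c) hA
    _ = ∫ ω in A, constraintSemigroup N τ (fun c => constraintInd N c (X s ω)) c ∂μ :=
        setIntegral_congr_ae (hX.tasepPast_le s _ hA)
          (hs.mono fun ω hω _ => tasepSemigroup_constraintInd τ hc hω)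
    _ = constraintSemigroup N τ (fun c => ∫ ω in A, constraintInd N c (X s ω) ∂μ) c :=
        integral_constraintSemigroup hintegrable (fun c ω => abs_constraintInd_le_one N c _) τ c
    _ = _ := by simp only [setIntegral_constraintInd (hX.measurable s)]

theorem IsStepTASEP.ae_mem_stepStates (hX : IsStepTASEP μ X) (T : ℝ≥0) :
    ∀ᵐ ω ∂μ, X T ω ∈ stepStates := by
  have hregion (n : ℕ+) : ∀ᵐ ω ∂μ, X T ω ∈ constraintRegion n 0 := by
    have hms (t : ℝ≥0) : MeasurableSet (X t ⁻¹' constraintRegion n 0) :=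
      hX.measurable t (measurableSet_constraintRegion n 0)
    have hinit : μ.real (X 0 ⁻¹' constraintRegion n 0) = 1 := by
      have : ∀ᵐ ω ∂μ, X 0 ω ∈ constraintRegion n 0 := by
        filter_upwards [hX.initial] with ω hω k _
        simp [hω k]
      rw [measureReal_def, (mem_ae_iff_prob_eq_one (hms 0)).1 this, ENNReal.toReal_one]
    have h := hX.measureReal_inter_add (N := n) hX.ae_initial_mem_stepStates T (c := 0)
      ⟨fun _ _ => rfl, fun _ _ => le_rfl⟩ MeasurableSet.univ
    simp only [Set.univ_inter, zero_add, constraintSemigroup_zero_right, hinit] at h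
    exact (mem_ae_iff_prob_eq_one (hms T)).2 ((ENNReal.toReal_eq_one_iff _).1 h)
  filter_upwards [hX.ordered T, ae_all_iff.2 hregion] with ω hanti hω
  refine ⟨hanti, fun n => ?_⟩
  have := hω n n le_rfl
  simp only [Pi.zero_apply] at this
  omega

end StepProcess

/-! ### Space-like joint distributions -/

section ChainDetConstraint

variable {r R : ℝ} {m : ℕ} {n : Fin m → ℕ} {t : Fin m → ℝ} {N : ℕ} {T : ℝ} {d : Fin m → ℕ}
  {c : ℕ → ℕ}

theorem respectsOrder_chainDet (hr : 0 < r) (hr1 : r < 1) :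
    RespectsOrder N fun c => chainDet r R n t N T (Sum.elim d c) := by
  intro c j v hj hjN hv
  simpa only [Sum.update_elim_inr] using
    chainDet_update_succ_of_le hr hr1 (c := Sum.elim d c) hj hjN hv

theorem hasDerivAt_chainDet_constraintGenerator (hr : 0 < r) (hr1 : r < 1) (hR : 0 < R)
    (hR1 : R < 1) (hc : IsAntitoneConstraint N c) :
    HasDerivAt (fun T => chainDet r R n t N T (Sum.elim d c))
      (constraintGenerator N (fun c => chainDet r R n t N T (Sum.elim d c)) c) T := by
  rw [(respectsOrder_chainDet hr hr1).constraintGenerator_eq_sum hc]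
  simpa only [Sum.update_elim_inr, Sum.elim_inr] using
    hasDerivAt_chainDet hr hr1 hR hR1 (c := Sum.elim d c) fun j hj _ => hc.2 j hj

end ChainDetConstraint

section JointDistribution

variable {Ω : Type*} {X : ℝ≥0 → Ω → (ℕ+ → ℤ)} {m : ℕ} {n : Fin m → ℕ+} {t : Fin m → ℝ≥0} {N : ℕ}
  {r R : ℝ} {s T : ℝ≥0} {d : Fin m → ℕ} {c : ℕ → ℕ}

/-- The event that, for every past point `i`, the particle `n i` has made at least `d i` jumps up to
time `t i`. A constraint with `d i = 0` is void, so that `t i` need not lie in the past then. -/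
def pastSet (X : ℝ≥0 → Ω → (ℕ+ → ℤ)) (n : Fin m → ℕ+) (t : Fin m → ℝ≥0) (d : Fin m → ℕ) : Set Ω :=
  {ω | ∀ i, 0 < d i → (d i : ℤ) ≤ X (t i) ω (n i) + (n i : ℕ)}

theorem measurableSet_pastSet (hd : ∀ i, 0 < d i → t i ≤ s) :
    MeasurableSet[tasepPast X s] (pastSet X n t d) := by
  simp only [pastSet, Set.ofPred_forall]
  refine MeasurableSet.iInter fun i => MeasurableSet.iInter fun hi => ?_
  have hjumps : Measurable fun x : ℕ+ → ℤ => x (n i) + ((n i : ℕ) : ℤ) :=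
    (measurable_pi_apply (n i)).add measurable_const
  exact (hjumps.comp (measurable_tasepPast (hd i hi))) measurableSet_Ici

theorem pastSet_eq_univ (hd : ∀ i, d i = 0) : pastSet X n t d = Set.univ :=
  Set.eq_univ_of_forall fun _ i hi => absurd (hd i) hi.ne'

theorem pastSet_inter_transfer {k : Fin m} (hkN : (n k : ℕ) ≤ N) :
    pastSet X n t (Function.update d k 0) ∩
        X (t k) ⁻¹' constraintRegion N (Function.update c (n k) (max (c (n k)) (d k))) =
      pastSet X n t d ∩ X (t k) ⁻¹' constraintRegion N c := by
  ext ω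
  constructor
  · rintro ⟨hpast, hcur⟩
    have hk := hcur _ hkN
    rw [Function.update_self, Nat.cast_max, max_le_iff] at hk
    refine ⟨fun i hi => ?_, fun j hj => ?_⟩
    · rcases eq_or_ne i k with rfl | hik
      · exact hk.2
      · have := hpast i
        rw [Function.update_of_ne hik] at this
        exact this hi
    · rcases eq_or_ne j (n k) with rfl | hjk
      · exact hk.1
      · simpa only [Function.update_of_ne (PNat.coe_injective.ne hjk)] using hcur j hj
  · rintro ⟨hpast, hcur⟩
    refine ⟨fun i hi => ?_, fun j hj => ?_⟩
    · rcases eq_or_ne i k with rfl | hik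
      · simp at hi
      · rw [Function.update_of_ne hik] at hi ⊢
        exact hpast i hi
    · rcases eq_or_ne j (n k) with rfl | hjk
      · have hk := hpast k
        have := hcur _ hj
        rw [Function.update_self]
        omega
      · simpa only [Function.update_of_ne (PNat.coe_injective.ne hjk)] using hcur j hj

variable [MeasurableSpace Ω] {μ : Measure Ω}

/-- The joint distribution at the past points and of the labels `1, …, N` at the current time `T` is
given by the determinant. -/
def HasChainDet (μ : Measure Ω) (X : ℝ≥0 → Ω → (ℕ+ → ℤ)) (r R : ℝ) (n : Fin m → ℕ+)
    (t : Fin m → ℝ≥0) (N : ℕ) (T : ℝ≥0) (d : Fin m → ℕ) (c : ℕ → ℕ) : Prop :=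
  ((μ.real (pastSet X n t d ∩ X T ⁻¹' constraintRegion N c) : ℝ) : ℂ) =
    chainDet r R (fun i => (n i : ℕ)) (fun i => (t i : ℝ)) N T (Sum.elim d c)

theorem hasChainDet_of_transfer (hr : 0 < r) {k : Fin m} (hkN : (n k : ℕ) ≤ N)
    (hd : ∀ i, k < i → d i = 0) (hc : ∀ j, (n k : ℕ) < j → c j = 0)
    (h : HasChainDet μ X r R n t N (t k) (Function.update d k 0)
      (Function.update c (n k) (max (c (n k)) (d k)))) :
    HasChainDet μ X r R n t N (t k) d c := by
  unfold HasChainDet at h ⊢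
  rw [chainDet_transfer hr rfl (n k).pos hkN hd hc]
  simp only [Sum.elim_inr, Sum.elim_inl, Sum.update_elim_inr, Sum.update_elim_inl]
  rw [← h, pastSet_inter_transfer hkN]

theorem hasChainDet_of_antitone (hX : IsStepTASEP μ X) (hr : 0 < r) (hr1 : r < 1) {ν : ℕ}
    (hν : ν ≤ N) (h : ∀ c, IsAntitoneConstraint ν c → HasChainDet μ X r R n t N T d c)
    (hc : ∀ j, ν < j → c j = 0) : HasChainDet μ X r R n t N T d c :=
  RespectsOrder.eq_of_forall_isAntitoneConstraint
    (fun _ _ _ hj hjN hv =>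
      congrArg Complex.ofReal (hX.respectsOrder_measureReal_inter T N _ hj hjN hv))
    (respectsOrder_chainDet hr hr1) hν h hc

theorem IsStepTASEP.measureReal_initial_eq_zero (hX : IsStepTASEP μ X) {j : ℕ} (hj : 1 ≤ j)
    (hjN : j ≤ N) (hcj : 0 < c j) (A : Set Ω) :
    μ.real (A ∩ X 0 ⁻¹' constraintRegion N c) = 0 := by
  refine (measureReal_congr (t := ∅) ?_).trans measureReal_empty
  filter_upwards [hX.initial] with ω hω
  refine propext ⟨fun hmem => ?_, False.elim⟩
  have hstart := hω ⟨j, hj⟩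
  have hcj' := hmem.2 ⟨j, hj⟩ hjN
  rw [hstart, PNat.mk_coe] at hcj'
  omega

variable [IsProbabilityMeasure μ]

theorem IsStepTASEP.measureReal_initial_eq_one (hX : IsStepTASEP μ X)
    (hc : ∀ j, 1 ≤ j → j ≤ N → c j = 0) : μ.real (X 0 ⁻¹' constraintRegion N c) = 1 := by
  refine (measureReal_congr ?_).trans (probReal_univ (μ := μ))
  filter_upwards [hX.initial] with ω hω
  refine propext ⟨fun _ => trivial, fun _ j hj => ?_⟩
  rw [hc j j.pos hj, hω j, neg_add_cancel, Nat.cast_zero]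

theorem hasChainDet_zero (hX : IsStepTASEP μ X) (hr : 0 < r) (hR : 0 < R) (hd : ∀ i, d i = 0) :
    HasChainDet μ X r R n t N 0 d c := by
  unfold HasChainDet
  rw [pastSet_eq_univ hd, NNReal.coe_zero]
  by_cases hc : ∀ j, 1 ≤ j → j ≤ N → c j = 0
  · rw [chainDet_eq_one hd hc, Set.univ_inter, hX.measureReal_initial_eq_one hc,
      Complex.ofReal_one]
  · push Not at hc
    obtain ⟨i, hi, hiN, hci⟩ := hc
    obtain ⟨j, hj, hmax⟩ := ((Finset.Icc 1 N).filter (c · ≠ 0)).exists_max_image id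
      ⟨i, Finset.mem_filter.2 ⟨Finset.mem_Icc.2 ⟨hi, hiN⟩, hci⟩⟩
    simp only [Finset.mem_filter, Finset.mem_Icc, id] at hj hmax
    have hcj := Nat.pos_of_ne_zero hj.2
    rw [hX.measureReal_initial_eq_zero hj.1.1 hj.1.2 hcj, Complex.ofReal_zero,
      chainDet_zero_eq_zero hr hR hd hj.1.1 hj.1.2 hcj]
    intro l hjl hlN
    by_contra hl
    have := hmax l ⟨⟨by omega, hlN⟩, hl⟩
    omega

theorem hasChainDet_add (hX : IsStepTASEP μ X) (hr : 0 < r) (hr1 : r < 1) (hR : 0 < R)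
    (hR1 : R < 1) (hd : ∀ i, 0 < d i → t i ≤ s) {ν : ℕ} (hν : ν ≤ N)
    (h : ∀ c, IsAntitoneConstraint ν c → HasChainDet μ X r R n t N s d c) (τ : ℝ≥0)
    (hc : IsAntitoneConstraint ν c) : HasChainDet μ X r R n t N (s + τ) d c := by
  unfold HasChainDet at h ⊢
  set A := pastSet X n t d
  rw [hX.measureReal_inter_add (hX.ae_mem_stepStates s) τ (hc.mono hν) (measurableSet_pastSet hd),
    NNReal.coe_add]
  refine eq_of_hasDerivAt_constraintGenerator (N := N)
    (H := fun c τ => ((constraintSemigroup N τ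
      (fun c => μ.real (A ∩ X s ⁻¹' constraintRegion N c)) c : ℝ) : ℂ))
    (H' := fun c τ => chainDet r R (fun i => (n i : ℕ)) (fun i => (t i : ℝ)) N (s + τ)
      (Sum.elim d c)) (fun c hc => ?_) (fun c _ τ => ?_) (fun c hc τ => ?_) hc τ
  · rw [constraintSemigroup_zero_left, h c hc, add_zero]
  · refine (hasDerivAt_constraintSemigroup (C := 1) (fun c => ?_) c τ).ofReal_comp.congr_deriv
      (map_constraintGenerator Complex.ofRealHom.toAddMonoidHom _ c)
    rw [abs_of_nonneg measureReal_nonneg]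
    exact measureReal_le_one
  · exact (hasDerivAt_chainDet_constraintGenerator hr hr1 hR hR1 (hc.mono hν)).comp_const_add _ _

theorem hasChainDet_of_spaceLike (hX : IsStepTASEP μ X) (hr : 0 < r) (hr1 : r < 1) (hR : 0 < R)
    (hR1 : R < 1) (hn : Antitone n) (ht : Monotone t) (hN : ∀ i, (n i : ℕ) ≤ N) (k : ℕ)
    (hd : ∀ i : Fin m, k ≤ i → d i = 0) (htT : ∀ i : Fin m, (i : ℕ) < k → t i ≤ T)
    (hcn : ∀ i : Fin m, (i : ℕ) < k → ∀ j, (n i : ℕ) < j → c j = 0) (hcN : ∀ j, N < j → c j = 0) :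
    HasChainDet μ X r R n t N T d c := by
  induction k generalizing T d c with
  | zero =>
    have hd' (i : Fin m) : d i = 0 := hd i i.1.zero_le
    refine hasChainDet_of_antitone hX hr hr1 le_rfl (fun c hc => ?_) hcN
    rw [← zero_add T]
    exact hasChainDet_add hX hr hr1 hR hR1 (fun i hi => absurd (hd' i) hi.ne') le_rfl
      (fun _ _ => hasChainDet_zero hX hr hR hd') T hc
  | succ k ih =>
    by_cases hkm : m ≤ k
    · exact ih (fun i hi => by omega) (fun i hi => htT i (by omega))
        (fun i hi => hcn i (by omega)) hcN
    obtain ⟨κ, rfl⟩ : ∃ κ : Fin m, (κ : ℕ) = k := ⟨⟨k, not_le.1 hkm⟩, rfl⟩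
    obtain ⟨τ, rfl⟩ := exists_add_of_le (htT κ κ.1.lt_succ_self)
    have hpast (i : Fin m) (hi : 0 < d i) : t i ≤ t κ :=
      ht (not_lt.1 fun hκi => hi.ne' (hd i (Nat.succ_le_of_lt hκi)))
    refine hasChainDet_of_antitone hX hr hr1 (hN κ) (fun c hc => ?_)
      (hcn κ κ.1.lt_succ_self)
    refine hasChainDet_add hX hr hr1 hR hR1 hpast (hN κ) (fun c hc => ?_) τ hc
    refine hasChainDet_of_transfer hr (hN κ) (fun i hi => hd i (Nat.succ_le_of_lt hi)) hc.1
      (ih (fun i hi => ?_) (fun i hi => ht (Fin.le_of_lt hi)) (fun i hi j hj => ?_) fun j hj => ?_)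
    · rcases eq_or_ne i κ with rfl | hiκ
      · exact Function.update_self ..
      · rw [Function.update_of_ne hiκ]
        exact hd i (by omega)
    · have : n κ ≤ n i := hn (Fin.le_of_lt hi)
      have : (n κ : ℕ) ≤ n i := this
      rw [Function.update_of_ne (by omega)]
      exact hc.1 j (by omega)
    · have := hN κ
      rw [Function.update_of_ne (by omega)]
      exact hc.1 j (by omega)

end JointDistribution

/-! ### Fredholm series -/

section FredholmSeries

theorem det_submatrix_eq_zero_of_not_injective {n κ α : Type*} [Fintype κ] [DecidableEq κ]
    [CommRing α] (A : Matrix n n α) {y : κ → n} (hy : ¬ Function.Injective y) :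
    (A.submatrix y y).det = 0 := by
  obtain ⟨i, j, hij, hne⟩ := Function.not_injective_iff.1 hy
  exact Matrix.det_zero_of_row_eq hne (by ext q; simp only [Matrix.submatrix_apply, hij])

variable {n α : Type*} [Fintype n] [DecidableEq n] [CommRing α]

theorem sum_det_submatrix_of_image_eq (A : Matrix n n α) {k : ℕ} {S : Finset n}
    (hS : S.card = k) :
    ∑ y : Fin k → n with Finset.univ.image y = S, (A.submatrix y y).det =
      k.factorial * principalMinor A S := by
  have hcard : Fintype.card (Fin k) = Fintype.card S := by
    rw [Fintype.card_fin, Fintype.card_coe, hS]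
  have hfactorial : k.factorial = Fintype.card (Fin k ≃ S) := by
    rw [Fintype.card_equiv (Fintype.equivOfCardEq hcard), Fintype.card_fin]
  rw [hfactorial, ← nsmul_eq_mul, ← Finset.card_univ, ← Finset.sum_const]
  refine (Finset.sum_bij (fun (e : Fin k ≃ S) _ a => (e a : n)) (fun e _ => ?_)
    (fun e _ e' _ h => ?_) (fun y hy => ?_) fun e _ => ?_).symm
  · refine Finset.mem_filter.2 ⟨Finset.mem_univ _, Finset.ext fun x => ?_⟩
    simp only [Finset.mem_image, Finset.mem_univ, true_and]
    exact ⟨fun ⟨a, ha⟩ => ha ▸ (e a).2, fun hx => ⟨e.symm ⟨x, hx⟩, by simp⟩⟩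
  · exact Equiv.ext fun a => Subtype.ext (congrFun h a)
  · obtain rfl := (Finset.mem_filter.1 hy).2
    let f (a : Fin k) : Finset.univ.image y := ⟨y a, Finset.mem_image_of_mem y (Finset.mem_univ a)⟩
    have hf : Function.Surjective f := by
      rintro ⟨x, hx⟩
      obtain ⟨a, -, rfl⟩ := Finset.mem_image.1 hx
      exact ⟨a, rfl⟩
    exact ⟨.ofBijective f ((Fintype.bijective_iff_surjective_and_card f).2 ⟨hf, hcard⟩),
      Finset.mem_univ _, rfl⟩
  · rw [principalMinor, ← Matrix.det_submatrix_equiv_self e, Matrix.submatrix_submatrix]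
    rfl

theorem sum_det_submatrix (A : Matrix n n α) (k : ℕ) :
    ∑ y : Fin k → n, (A.submatrix y y).det =
      k.factorial * ∑ S ∈ Finset.univ.powersetCard k, principalMinor A S := by
  rw [← Finset.sum_fiberwise_of_maps_to (s := Finset.univ) (t := Finset.univ)
      (g := fun y : Fin k → n => Finset.univ.image y) fun _ _ => Finset.mem_univ _,
    Finset.mul_sum]
  refine (Finset.sum_subset_zero_on_sdiff (Finset.subset_univ _) (fun S hS => ?_)
    fun S hS => ?_).symm
  · rw [Finset.mem_sdiff, Finset.mem_powersetCard_univ] at hS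
    refine Finset.sum_eq_zero fun y hy => det_submatrix_eq_zero_of_not_injective A fun hinj => ?_
    rw [← (Finset.mem_filter.1 hy).2, Finset.card_image_of_injective _ hinj] at hS
    simp at hS
  · exact (sum_det_submatrix_of_image_eq A (Finset.mem_powersetCard_univ.1 hS)).symm

theorem hasSum_det_one_sub (A : Matrix n n ℂ) :
    HasSum (fun k : ℕ => ((-1 : ℂ) ^ k / (k.factorial : ℂ)) *
      ∑ y : Fin k → n, (A.submatrix y y).det) (1 - A).det := by
  set P : Polynomial ℂ :=
    (1 + (Polynomial.X : Polynomial ℂ) • A.map Polynomial.C).det with hP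
  have hterm (k : ℕ) : ((-1 : ℂ) ^ k / (k.factorial : ℂ)) *
      ∑ y : Fin k → n, (A.submatrix y y).det = P.coeff k * (-1) ^ k := by
    have := Nat.cast_ne_zero (R := ℂ).2 k.factorial_ne_zero
    simp only [sum_det_submatrix, hP, Matrix.coeff_det_one_add_X_smul_eq_sum_minors, principalMinor]
    field_simp
  have heval : (1 - A).det = P.eval (-1) := by
    rw [hP, ← Polynomial.coe_evalRingHom, RingHom.map_det]
    congr 1
    ext i j
    simp [Matrix.one_apply, apply_ite (Polynomial.eval (-1 : ℂ)), sub_eq_add_neg]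
  simp only [hterm]
  rw [heval, Polynomial.eval_eq_sum_range]
  refine hasSum_sum_of_ne_finset_zero fun k hk => ?_
  rw [Polynomial.coeff_eq_zero_of_natDegree_lt (by simpa [Nat.lt_succ_iff] using hk), zero_mul]

end FredholmSeries

theorem hasFredholmDet_of_finite {I : Type*} [DecidableEq I] {K : Matrix I I ℂ} (W : Finset I)
    (hK : ∀ (k : ℕ) (y : Fin k → I), (∃ i, y i ∉ W) → (K.submatrix y y).det = 0) :
    HasFredholmDet K (principalMinor (1 - K) W) := by
  have hzero (k : ℕ) (y : Fin k → I) (hy : y ∉ Fintype.piFinset fun _ => W) :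
      (K.submatrix y y).det = 0 :=
    hK k y (by simpa [Fintype.mem_piFinset] using hy)
  refine ⟨fun k => summable_of_ne_finset_zero (hzero k), ?_⟩
  let A : Matrix W W ℂ := K.submatrix (↑) (↑)
  have hsum (k : ℕ) : ∑' y : Fin k → I, (K.submatrix y y).det =
      ∑ y : Fin k → W, (A.submatrix y y).det := by
    rw [tsum_eq_sum (hzero k)]
    refine (Finset.sum_bij (fun (y : Fin k → W) _ a => (y a : I)) (fun y _ => ?_)
      (fun y _ y' _ h => ?_) (fun y hy => ?_) fun y _ => rfl).symm
    · exact Fintype.mem_piFinset.2 fun a => (y a).2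
    · exact funext fun a => Subtype.ext (congrFun h a)
    · exact ⟨fun a => ⟨y a, Fintype.mem_piFinset.1 hy a⟩, Finset.mem_univ _, rfl⟩
  have hdet : principalMinor (1 - K) W = (1 - A).det := by
    rw [principalMinor, Matrix.submatrix_sub, Pi.sub_apply, Pi.sub_apply,
      Matrix.submatrix_one _ Subtype.val_injective]
  rw [hdet]
  exact (hasSum_det_one_sub A).congr_fun fun k => congrArg _ (hsum k)

theorem HasFredholmDet.of_comp_equiv {I J : Type*} {K : I → I → ℂ} {d : ℂ} (e : J ≃ I)
    (h : HasFredholmDet (fun p q => K (e p) (e q)) d) : HasFredholmDet K d := by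
  let φ (k : ℕ) : (Fin k → J) ≃ (Fin k → I) := .arrowCongr (.refl _) e
  refine ⟨fun k => (φ k).summable_iff.1 (h.1 k), ?_⟩
  refine h.2.congr_fun fun k => congrArg _ ?_
  exact ((φ k).tsum_eq _).symm

section RestrictedCoordinates

variable {κ ι β E : Type*} [NormedAddCommGroup E] [CompleteSpace E] {g : (κ → ι × β) → E}
  {P : ι → β → Prop}

theorem summable_restrict_pi (hg : Summable g) (P : ι → β → Prop) (l : κ → ι) :
    Summable fun x : (i : κ) → {b : β // P (l i) b} => g fun i => (l i, x i) :=
  hg.comp_injective fun _ _ h =>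
    funext fun i => Subtype.ext (Prod.ext_iff.1 (congrFun h i)).2

theorem tsum_pi_prod_eq_sum_tsum [Fintype κ] [DecidableEq κ] [Fintype ι] (hg : Summable g)
    (hzero : ∀ y, (∃ i, ¬ P (y i).1 (y i).2) → g y = 0) :
    ∑' y, g y = ∑ l : κ → ι, ∑' x : (i : κ) → {b : β // P (l i) b}, g fun i => (l i, x i) := by
  let e : (κ → ι) × (κ → β) ≃ (κ → ι × β) := (Equiv.arrowProdEquivProdArrow κ _ _).symm
  have hrestrict (l : κ → ι) : ∑' x : (i : κ) → {b : β // P (l i) b}, g (fun i => (l i, x i)) =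
      ∑' x : κ → β, g (e (l, x)) := by
    let φ (x : (i : κ) → {b : β // P (l i) b}) (i : κ) : β := x i
    have hφ : Function.Injective φ := fun _ _ h => funext fun i => Subtype.ext (congrFun h i)
    refine hφ.tsum_eq (f := fun x => g (e (l, x))) fun x hx => ?_
    by_contra hrange
    refine hx (hzero _ ?_)
    by_contra! hP
    exact hrange ⟨fun i => ⟨x i, hP i⟩, rfl⟩
  simp only [hrestrict]
  rw [← tsum_fintype (L := SummationFilter.unconditional _)]
  exact (e.tsum_eq g).symm.trans (e.summable_iff.2 hg).tsum_prod

end RestrictedCoordinates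

section CutKernel

variable {m : ℕ} {s : Fin m → ℝ} {K : Fin m × ℤ → Fin m × ℤ → ℂ} {k : ℕ}

theorem det_cutKernel_eq_zero {y : Fin k → Fin m × ℤ} (hy : ∃ i, ¬ ((y i).2 : ℝ) < s (y i).1) :
    (Matrix.of fun i j => cutKernel s K (y i) (y j)).det = 0 := by
  obtain ⟨i, hi⟩ := hy
  refine Matrix.det_eq_zero_of_row_eq_zero i fun j => ?_
  rw [Matrix.of_apply, cutKernel, if_neg hi, zero_mul, zero_mul]

theorem cutKernel_of_lt {p q : Fin m × ℤ} (hp : (p.2 : ℝ) < s p.1) (hq : (q.2 : ℝ) < s q.1) :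
    cutKernel s K p q = K p q := by
  rw [cutKernel, if_pos hp, if_pos hq, one_mul, mul_one]

theorem det_cutKernel_of_lt {l : Fin k → Fin m} (x : (i : Fin k) → {y : ℤ // (y : ℝ) < s (l i)}) :
    (Matrix.of fun i j => cutKernel s K (l i, x i) (l j, x j)).det =
      (Matrix.of fun i j => K (l i, x i) (l j, x j)).det :=
  congrArg Matrix.det (Matrix.ext fun i j => cutKernel_of_lt (x i).2 (x j).2)

theorem HasFredholmDet.summable_halfLines {d : ℂ} (h : HasFredholmDet (cutKernel s K) d)
    (l : Fin k → Fin m) :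
    Summable fun x : (i : Fin k) → {y : ℤ // (y : ℝ) < s (l i)} =>
      (Matrix.of fun i j => K (l i, x i) (l j, x j)).det :=
  (summable_restrict_pi (h.1 k) (fun i (y : ℤ) => (y : ℝ) < s i) l).congr det_cutKernel_of_lt

theorem HasFredholmDet.hasSum_halfLines {d : ℂ} (h : HasFredholmDet (cutKernel s K) d) :
    HasSum (fun k : ℕ => ((-1 : ℂ) ^ k / (k.factorial : ℂ)) *
      ∑ l : Fin k → Fin m, ∑' x : (i : Fin k) → {y : ℤ // (y : ℝ) < s (l i)},
        (Matrix.of fun i j => K (l i, x i) (l j, x j)).det) d := by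
  refine h.2.congr_fun fun k => congrArg _ ?_
  rw [tsum_pi_prod_eq_sum_tsum (P := fun i (y : ℤ) => (y : ℝ) < s i) (h.1 k)
    fun _ => det_cutKernel_eq_zero]
  simp only [det_cutKernel_of_lt]

end CutKernel

/-! ### The cut kernel -/

section ShiftedKernel

variable {r R : ℝ} {ι : Type*} [LinearOrder ι] {lab : ι → ℕ} {tim : ι → ℝ}

theorem exists_forall_shiftedKernel_eq_zero (hr : 0 < r) (hr1 : r < 1) {κ : Type*} [Finite κ]
    {y : κ → ι × ℤ} (hy : ∃ i, (y i).2 < 0) :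
    ∃ i, ∀ j, shiftedKernel r R lab tim (· < ·) (y i) (y j) = 0 := by
  obtain ⟨i, hi, hmin⟩ := Set.exists_min_image {i | (y i).2 < 0} (fun i => (y i).1)
    (Set.toFinite _) hy
  refine ⟨i, fun j => ?_⟩
  rw [shiftedKernel, Matrix.of_apply, finiteRankKernel_of_neg hr hr1 _ _ hi, add_zero, neg_eq_zero,
    ite_eq_right_iff]
  intro hlt
  have hj : 0 ≤ (y j).2 := not_lt.1 fun hj => hlt.not_ge (hmin j hj)
  exact kernelPsi_of_neg hr hr1 _ (by have : (y i).2 < 0 := hi; omega)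

end ShiftedKernel

/-- The least number of steps to the right that lead from `-k` to a site `x ≥ a`. -/
noncomputable def requiredSteps (k : ℕ) (a : ℝ) : ℕ := (⌈a⌉ + k).toNat

theorem lt_requiredSteps_iff {k : ℕ} {a : ℝ} {u : ℤ} (hu : 0 ≤ u) :
    u < requiredSteps k a ↔ ((u - k : ℤ) : ℝ) < a := by
  rw [← Int.lt_ceil, requiredSteps]
  omega

theorem mem_siteWindow_requiredSteps {ι : Type*} [Fintype ι] {lab : ι → ℕ} {s : ι → ℝ}
    {p : ι × ℤ} :
    p ∈ siteWindow Finset.univ (fun i => requiredSteps (lab i) (s i)) ↔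
      0 ≤ p.2 ∧ ((p.2 - lab p.1 : ℤ) : ℝ) < s p.1 :=
  mem_siteWindow.trans <|
    (and_iff_right (Finset.mem_univ _)).trans (and_congr_right lt_requiredSteps_iff)

section Chain

variable {m : ℕ} {r R : ℝ}

theorem chainDet_elim_zero (n : Fin m → ℕ) (t : Fin m → ℝ) (N : ℕ) (T : ℝ) (d : Fin m → ℕ) :
    chainDet r R n t N T (Sum.elim d 0) =
      principalMinor (1 - shiftedKernel r R n t (· < ·)) (siteWindow Finset.univ d) := by
  let f : Fin m × ℤ ↪ (Fin m ⊕ ℕ) × ℤ := Function.Embedding.inl.prodMap (.refl ℤ)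
  have hwindow :
      siteWindow (chainPoints m N) (Sum.elim d 0) = (siteWindow Finset.univ d).map f := by
    ext ⟨a | a, u⟩
    · simp [mem_siteWindow, f, inl_mem_chainPoints]
    · simp only [mem_siteWindow, Finset.mem_map, f]
      simp
  rw [chainDet, hwindow, principalMinor_map, chainMatrix, Matrix.submatrix_sub, Pi.sub_apply,
    Pi.sub_apply, Matrix.submatrix_one_embedding]
  congr 2
  ext p q
  simp [shiftedKernel, f]

variable {n : Fin m → ℕ+} {t : Fin m → ℝ≥0} {s : Fin m → ℝ}

theorem spaceLikePrec_iff_lt (hnt : ∀ i j : Fin m, i < j →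
    SpaceLikePrec ((n i : ℕ), (t i : ℝ)) ((n j : ℕ), (t j : ℝ))) (i j : Fin m) :
    SpaceLikePrec ((n i : ℕ), (t i : ℝ)) ((n j : ℕ), (t j : ℝ)) ↔ i < j := by
  refine ⟨fun h => ?_, hnt i j⟩
  rcases lt_trichotomy i j with hij | rfl | hij
  · exact hij
  · exact absurd rfl h.2.2
  · have h' := hnt j i hij
    exact absurd (Prod.ext (le_antisymm h'.1 h.1) (le_antisymm h.2.1 h'.2.1)) h.2.2

theorem tasepKernel_eq_shiftedKernel (hr : 0 < r) (hR : 0 < R) (hrR : r + R < 1)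
    (hnt : ∀ i j : Fin m, i < j →
      SpaceLikePrec ((n i : ℕ), (t i : ℝ)) ((n j : ℕ), (t j : ℝ))) (p q : Fin m × ℤ) :
    tasepKernel r R (n p.1) (t p.1) (p.2 - (n p.1 : ℕ)) (n q.1) (t q.1) (q.2 - (n q.1 : ℕ)) =
      shiftedKernel r R (fun i => (n i : ℕ)) (fun i => (t i : ℝ)) (· < ·) p q := by
  classical
  rw [tasepKernel_eq_neg_add hr hR hrR, shiftedKernel, Matrix.of_apply]
  simp only [spaceLikePrec_iff_lt hnt, sub_add_cancel]

theorem hasFredholmDet_cutKernel (hr : 0 < r) (hR : 0 < R) (hrR : r + R < 1)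
    (hnt : ∀ i j : Fin m, i < j →
      SpaceLikePrec ((n i : ℕ), (t i : ℝ)) ((n j : ℕ), (t j : ℝ))) (N : ℕ) (T : ℝ) :
    HasFredholmDet
      (cutKernel s fun p q => tasepKernel r R (n p.1) (t p.1) p.2 (n q.1) (t q.1) q.2)
      (chainDet r R (fun i => (n i : ℕ)) (fun i => (t i : ℝ)) N T
        (Sum.elim (fun i => requiredSteps (n i) (s i)) 0)) := by
  let K (p q : Fin m × ℤ) : ℂ := tasepKernel r R (n p.1) (t p.1) p.2 (n q.1) (t q.1) q.2
  let e : Fin m × ℤ ≃ Fin m × ℤ := .prodShear (.refl _) fun i => .subRight ((n i : ℕ) : ℤ)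
  let L := shiftedKernel r R (fun i => (n i : ℕ)) (fun i => (t i : ℝ)) (· < ·)
  let M : Matrix (Fin m × ℤ) (Fin m × ℤ) ℂ := .of fun p q => cutKernel s K (e p) (e q)
  let W := siteWindow Finset.univ fun i => requiredSteps (n i) (s i)
  have hKL (p q : Fin m × ℤ) : K (e p) (e q) = L p q :=
    tasepKernel_eq_shiftedKernel hr hR hrR hnt p q
  have hW {p : Fin m × ℤ} : p ∈ W ↔ 0 ≤ p.2 ∧ ((e p).2 : ℝ) < s (e p).1 :=
    mem_siteWindow_requiredSteps
  have hminor : principalMinor (1 - L) W = principalMinor (1 - M) W := by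
    refine congrArg Matrix.det (Matrix.ext fun p q => congrArg ((1 : Matrix _ _ ℂ) p.1 q.1 - ·) ?_)
    exact (hKL p q).symm.trans (cutKernel_of_lt (hW.1 p.2).2 (hW.1 q.2).2).symm
  rw [chainDet_elim_zero]
  refine .of_comp_equiv e (hminor ▸ hasFredholmDet_of_finite (K := M) W fun k y ⟨i, hi⟩ => ?_)
  by_cases hneg : ∃ i, (y i).2 < 0
  · obtain ⟨i, hrow⟩ := exists_forall_shiftedKernel_eq_zero (R := R)
      (lab := fun i => (n i : ℕ)) (tim := fun i => (t i : ℝ)) hr (by linarith) hneg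
    have hKrow (j : Fin k) : K (e (y i)) (e (y j)) = 0 := (hKL _ _).trans (hrow j)
    exact Matrix.det_eq_zero_of_row_eq_zero i fun j => mul_eq_zero_of_left
      (mul_eq_zero_of_right _ (hKrow j)) _
  · push Not at hneg
    exact det_cutKernel_eq_zero ⟨i, fun h => hi (hW.2 ⟨hneg i, h⟩)⟩

end Chain

section Event

variable {Ω : Type*} [MeasurableSpace Ω] {μ : Measure Ω} [IsProbabilityMeasure μ]
  {X : ℝ≥0 → Ω → (ℕ+ → ℤ)} {m : ℕ}

theorem IsStepTASEP.measureReal_forall_le (hX : IsStepTASEP μ X) (n : Fin m → ℕ+)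
    (t : Fin m → ℝ≥0) (s : Fin m → ℝ) (N : ℕ) (T : ℝ≥0) :
    μ.real {ω | ∀ k : Fin m, s k ≤ (X (t k) ω (n k) : ℝ)} =
      μ.real (pastSet X n t (fun i => requiredSteps (n i) (s i)) ∩
        X T ⁻¹' constraintRegion N 0) := by
  refine measureReal_congr ?_
  filter_upwards [ae_all_iff.2 fun i => hX.ae_mem_stepStates (t i), hX.ae_mem_stepStates T]
    with ω hpast hcur
  have hcur' : X T ω ∈ constraintRegion N 0 := fun j _ => neg_le_iff_add_nonneg.1 (hcur.2 j)
  refine propext (Iff.trans (forall_congr' fun i => ?_) (and_iff_left hcur').symm)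
  have hsteps := neg_le_iff_add_nonneg.1 ((hpast i).2 (n i))
  have hiff := lt_requiredSteps_iff (k := n i) (a := s i) hsteps
  rw [add_sub_cancel_right] at hiff
  rw [← not_lt, ← hiff]
  beta_reduce
  omega

end Event

theorem mainTheorem5 {Ω : Type*} [MeasurableSpace Ω] (μ : Measure Ω) [IsProbabilityMeasure μ]
    (X : ℝ≥0 → Ω → (ℕ+ → ℤ)) (hX : IsStepTASEP μ X)
    (m : ℕ) (n : Fin m → ℕ+) (t : Fin m → ℝ≥0) (s : Fin m → ℝ)
    (hnt : ∀ i j : Fin m, i < j →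
      SpaceLikePrec ((n i : ℕ), (t i : ℝ)) ((n j : ℕ), (t j : ℝ)))
    (r R : ℝ) (hr : 0 < r) (hR : 0 < R) (hrR : r + R < 1) :
    HasFredholmDet
      (cutKernel s fun p q => tasepKernel r R (n p.1) (t p.1) p.2 (n q.1) (t q.1) q.2)
      ((μ.real {ω | ∀ k : Fin m, s k ≤ (X (t k) ω (n k) : ℝ)} : ℝ) : ℂ) ∧
    (∀ (k : ℕ) (l : Fin k → Fin m),
      Summable fun x : (i : Fin k) → {y : ℤ // (y : ℝ) < s (l i)} =>
        (Matrix.of fun i j : Fin k =>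
          tasepKernel r R (n (l i)) (t (l i)) (x i) (n (l j)) (t (l j)) (x j)).det) ∧
    HasSum
      (fun k : ℕ => ((-1 : ℂ) ^ k / (k.factorial : ℂ)) *
        ∑ l : Fin k → Fin m, ∑' x : (i : Fin k) → {y : ℤ // (y : ℝ) < s (l i)},
          (Matrix.of fun i j : Fin k =>
            tasepKernel r R (n (l i)) (t (l i)) (x i) (n (l j)) (t (l j)) (x j)).det)
      ((μ.real {ω | ∀ k : Fin m, s k ≤ (X (t k) ω (n k) : ℝ)} : ℝ) : ℂ) := by
  have hn : Antitone n := antitone_iff_forall_lt.2 fun i j hij => (hnt i j hij).1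
  have ht : Monotone t := monotone_iff_forall_lt.2 fun i j hij => (hnt i j hij).2.1
  have hN (i : Fin m) : (n i : ℕ) ≤ ∑ i, (n i : ℕ) :=
    Finset.single_le_sum_of_canonicallyOrdered (f := fun i => (n i : ℕ)) (Finset.mem_univ i)
  have hT (i : Fin m) : t i ≤ ∑ i, t i :=
    Finset.single_le_sum_of_canonicallyOrdered (Finset.mem_univ i)
  have hdet : HasChainDet μ X r R n t (∑ i, (n i : ℕ)) (∑ i, t i)
      (fun i => requiredSteps (n i) (s i)) 0 :=
    hasChainDet_of_spaceLike hX hr (by linarith) hR (by linarith) hn ht hN m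
      (fun i hi => absurd i.2 hi.not_gt) (fun i _ => hT i) (fun _ _ _ _ => rfl) fun _ _ => rfl
  have hF := hasFredholmDet_cutKernel (s := s) hr hR hrR hnt (∑ i, (n i : ℕ)) (∑ i, t i : ℝ≥0)
  rw [hX.measureReal_forall_le n t s (∑ i, (n i : ℕ)) (∑ i, t i), hdet]
  exact ⟨hF, fun _ => hF.summable_halfLines, hF.hasSum_halfLines⟩
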